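/- For integers $n\ge 2$, $r\ge 1$ let $V_{n,r}$ be the free algebra on $x_1,\dots,x_r$ in the variety of algebras with unary operations $\alpha_1,\dots,\alpha_n$ and one $n$-ary operation $\lambda$ (operations are written on the right) satisfying the laws $(w\alpha_1,\dots,w\alpha_n)\lambda=w$ and $(w_1,\dots,w_n)\lambda\alpha_i=w_i$ for $1\le i\le n$. Let $G_{n,r}$ be the group of automorphisms of $V_{n,r}$. The $\psi$-orbit of $y\in V_{n,r}$ is $\{y\psi^m : m\in\mathbb Z\}$. Elements of $V_{n,r}$ are given by words in the operations and generators, and $\psi\in G_{n,r}$ is given by a finite list of pairs of words $(y,y\psi)$, where the elements $y$ form a finite basis (free generating set) of $V_{n,r}$. Then there is an algorithm which, given $n\ge 2$, $r\ge 1$, an automorphism $\psi\in G_{n,r}$ and elements $u,v\in V_{n,r}$, always halts, decides whether or not $u$ and $v$ lie in the same $\psi$-orbit, and, if they do, finds the integers $m$ for which $u\psi^m=v$: it outputs $m_0\in\mathbb Z$ and an integer $k\ge 0$ such that $$\{m\in\mathbb Z : u\psi^m=v\}=\{m_0+kt : t\in\mathbb Z\}$$ (so $m_0$ is the only solution when $k=0$).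 -/

import Mathlib

namespace Higman

/-- An algebra for the operator domain with `n` unary operations (the descending operations
`α₁, …, αₙ`, indexed by `Fin n`) and one `n`-ary operation (the contraction `lam`). -/
class OmegaAlgebra (n : ℕ) (S : Type*) where
  desc : Fin n → S → S
  contr : (Fin n → S) → S

/-- The variety `𝒱ₙ`: the algebras that satisfy `(w α₁, …, w αₙ) lam = w` and
`(w₁, …, wₙ) lam αᵢ = wᵢ`. -/
class VarietyAlgebra (n : ℕ) (S : Type*) extends OmegaAlgebra n S where
  contr_desc : ∀ w : S, contr (fun i => desc i w) = w
  desc_contr : ∀ (w : Fin n → S) (i : Fin n), desc i (contr w) = w i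

/-- Homomorphisms of algebras. -/
structure IsHom (n : ℕ) {S T : Type*} [OmegaAlgebra n S] [OmegaAlgebra n T] (f : S → T) :
    Prop where
  map_desc : ∀ (i : Fin n) (w : S), f (OmegaAlgebra.desc i w) = OmegaAlgebra.desc i (f w)
  map_contr : ∀ w : Fin n → S, f (OmegaAlgebra.contr w) = OmegaAlgebra.contr (fun i => f (w i))

/-- The words in the operations and the generators `x₁, …, x_r` (indexed by `Fin r`). -/
inductive Word (n r : ℕ) : Type
  | gen : Fin r → Word n r
  | desc : Fin n → Word n r → Word n r
  | contr : (Fin n → Word n r) → Word n r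

/-- The congruence on words generated by the two laws of `𝒱ₙ`. -/
inductive Rel (n r : ℕ) : Word n r → Word n r → Prop
  | refl (w) : Rel n r w w
  | symm {w w'} : Rel n r w w' → Rel n r w' w
  | trans {w w' w''} : Rel n r w w' → Rel n r w' w'' → Rel n r w w''
  | desc (i) {w w'} : Rel n r w w' → Rel n r (.desc i w) (.desc i w')
  | contr {w w' : Fin n → Word n r} : (∀ i, Rel n r (w i) (w' i)) →
      Rel n r (.contr w) (.contr w')
  | contr_desc (w) : Rel n r (.contr fun i => .desc i w) w
  | desc_contr (w : Fin n → Word n r) (i) : Rel n r (.desc i (.contr w)) (w i)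

def wordSetoid (n r : ℕ) : Setoid (Word n r) where
  r := Rel n r
  iseqv := ⟨Rel.refl, Rel.symm, Rel.trans⟩

/-- The Higman algebra `V_{n,r}`: words modulo the laws of `𝒱ₙ`. -/
def V (n r : ℕ) : Type := Quotient (wordSetoid n r)

/-- The element of `V_{n,r}` that a word represents. -/
def Word.toV {n r : ℕ} (w : Word n r) : V n r := Quotient.mk (wordSetoid n r) w

theorem Word.toV_eq_iff {n r : ℕ} {w w' : Word n r} : w.toV = w'.toV ↔ Rel n r w w' :=
  Quotient.eq (r := wordSetoid n r)

theorem V.exists_word {n r : ℕ} (a : V n r) : ∃ w : Word n r, w.toV = a :=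
  Quotient.exists_rep a

noncomputable instance (n r : ℕ) : OmegaAlgebra n (V n r) where
  desc i a := (Word.desc i (Quotient.out a)).toV
  contr a := (Word.contr fun i => Quotient.out (a i)).toV

/-- The operations of `V_{n,r}` are computed on arbitrary representatives. -/
theorem V.desc_toV {n r : ℕ} (i : Fin n) (w : Word n r) :
    OmegaAlgebra.desc i w.toV = (Word.desc i w).toV :=
  Word.toV_eq_iff.2 (Rel.desc i (Word.toV_eq_iff.1 (Quotient.out_eq w.toV)))

theorem V.contr_toV {n r : ℕ} (w : Fin n → Word n r) :
    OmegaAlgebra.contr (fun i => (w i).toV) = (Word.contr w).toV :=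
  Word.toV_eq_iff.2 (Rel.contr fun i => Word.toV_eq_iff.1 (Quotient.out_eq (w i).toV))

noncomputable instance (n r : ℕ) : VarietyAlgebra n (V n r) where
  contr_desc a := by
    obtain ⟨w, rfl⟩ := V.exists_word a
    simp only [V.desc_toV, V.contr_toV]
    exact Word.toV_eq_iff.2 (Rel.contr_desc w)
  desc_contr a i := by
    choose w hw using fun j => V.exists_word (a j)
    obtain rfl : (fun j => (w j).toV) = a := funext hw
    simp only [V.desc_toV, V.contr_toV]
    exact Word.toV_eq_iff.2 (Rel.desc_contr w i)

/-- The Higman–Thompson group `G_{n,r}`: the automorphisms of the algebra `V_{n,r}`. -/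
def G (n r : ℕ) : Subgroup (Equiv.Perm (V n r)) where
  carrier := {e | IsHom n e}
  one_mem' := ⟨fun _ _ => rfl, fun _ => rfl⟩
  mul_mem' {e f} he hf :=
    ⟨fun i w => by simp [hf.map_desc, he.map_desc],
      fun w => by simp [hf.map_contr, he.map_contr]⟩
  inv_mem' {e} he :=
    ⟨fun i w => e.injective (by simp [he.map_desc]),
      fun w => e.injective (by simp [he.map_contr])⟩

/-- A basis (free generating set) of `V_{n,r}`: every map from `Y` to an algebra in `𝒱ₙ` extends
uniquely to a homomorphism. -/
def IsBasis {n r : ℕ} (Y : Set (V n r)) : Prop :=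
  ∀ (S : Type) [VarietyAlgebra n S] (θ : Y → S),
    ∃! f : V n r → S, IsHom n f ∧ ∀ y : Y, f y = θ y

/-- A finite list of pairs of words describes the automorphism `ψ` if the left-hand words represent
the elements of a (finite) basis and each right-hand word represents the image under `ψ` of the
element given by the left-hand word. -/
def Describes {n r : ℕ} (L : List (Word n r × Word n r)) (ψ : G n r) : Prop :=
  IsBasis {y : V n r | ∃ p ∈ L, p.1.toV = y} ∧
    ∀ p ∈ L, (ψ : Equiv.Perm (V n r)) p.1.toV = p.2.toV

/-- The `ψ`-orbit of `y`. -/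
def orbit {n r : ℕ} (ψ : G n r) (y : V n r) : Set (V n r) :=
  {w | ∃ m : ℤ, ((ψ ^ m : G n r) : Equiv.Perm (V n r)) y = w}

/-- The letters in which words are written down as input of an algorithm. -/
inductive Letter : Type
  | gen : ℕ → Letter
  | desc : ℕ → Letter
  | lam : Letter

def letterEquiv : Letter ≃ ℕ ⊕ ℕ ⊕ Unit where
  toFun
    | .gen i => .inl i
    | .desc i => .inr (.inl i)
    | .lam => .inr (.inr ())
  invFun
    | .inl i => .gen i
    | .inr (.inl i) => .desc i
    | .inr (.inr _) => .lam
  left_inv a := by cases a <;> rfl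
  right_inv a := by rcases a with _ | _ | _ <;> rfl

instance : Primcodable Letter := Primcodable.ofEquiv _ letterEquiv

/-- The word written as a finite sequence of letters, each operation after its arguments. -/
def Word.toRow {n r : ℕ} : Word n r → List Letter
  | .gen i => [.gen i]
  | .desc i w => w.toRow ++ [.desc i]
  | .contr w => (List.ofFn fun i => (w i).toRow).flatten ++ [.lam]

/-- Inputs of the orbit-sharing problem: `n` and `r`, the written form of a list of pairs of words,
and the written forms of two words. -/
abbrev OrbitInput : Type :=
  (ℕ × ℕ) × List (List Letter × List Letter) × (List Letter × List Letter)

def orbitInput {n r : ℕ} (L : List (Word n r × Word n r)) (u v : Word n r) : OrbitInput :=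
  ((n, r), L.map fun p => (p.1.toRow, p.2.toRow), (u.toRow, v.toRow))

/-- Correct answers to the orbit-sharing problem: `none` if `u` and `v` lie in different
`ψ`-orbits, and `some (m₀, k)` if they lie in the same one and the integers `m` with `u ψ ^ m = v`
are exactly the `m₀ + k t`, `t ∈ ℤ` (so `m₀` is the only one if `k = 0`). -/
def IsOrbitAnswer {n r : ℕ} (ψ : G n r) (u v : V n r) : Option (ℤ × ℕ) → Prop
  | none => orbit ψ u ≠ orbit ψ v
  | some (m₀, k) => orbit ψ u = orbit ψ v ∧
      {m : ℤ | ((ψ ^ m : G n r) : Equiv.Perm (V n r)) u = v} = {m : ℤ | ∃ t : ℤ, m = m₀ + k * t}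

end Higman

/-!
The algorithm is an unbounded search for a certificate that some answer is correct. Two things make
it work: whether a given object is a certificate is primitive recursive, and every input has one.

**Nodes.** A path `p = [i₁, …, iₖ]` acts on an element `x` by `x p = x α_{i₁} ⋯ α_{iₖ}`
(`Higman.descs`), and two elements are equal as soon as their descendants along all paths of some
fixed length are (`Higman.eq_of_forall_descs`). Along every long enough path an element `x` of
`V_{n,r}` descends to a *node* `x_g q`, and distinct nodes are distinct elements
(`Higman.node_injective`). Which node this is can be computed from a word for `x`
(`Higman.NodeAt`). Likewise, the list that describes `ψ` yields the value of `ψ` and of `ψ⁻¹` at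
every deep node, and these values are nodes again, because a basis and its image under `ψ` both
generate `V_{n,r}` (`Higman.exists_fact`). So `u ψ ^ m = v` and `u ψ ^ m ≠ v` both have finite
certificates for each single `m`.

**Infinite orbits.** It remains to certify that only finitely many `m` come into question. Let `x`
have an infinite orbit. By compactness there is an infinite path along which all descendants of `x`
have infinite orbits. If one of these descendants goes through deep nodes only, then by the
pigeonhole principle its orbit contains a node `t s` such that some `ψ ^ k` takes `t` to a proper
descendant `t Γ`; it then goes on through `t Γ s`, `t Γ Γ s`, … and gets deeper than any given
node. Otherwise every descendant far along the path comes close to the root at some time, two of them at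
the same node, and then a descendant `w` satisfies `w ψ ^ k = w Γ` or `w Γ ψ ^ k = w` with `Γ ≠ []`.
This is `Higman.Tracks.exists_grows_or_hyperbolic`. In the second case the descendants of `w` along
powers of `Γ` grow under `ψ` or under `ψ⁻¹`.

**Different orbits.** If `u` has an infinite orbit and `v` lies in a different orbit, one applies
this to `u`, and to `v` if `v` has an infinite orbit too. Either both grow under `ψ`, or both grow
under `ψ⁻¹`, and then only finitely many `m` are left to be tested; or some relation
`u p ψ ^ k = u p'` fails for `v` or conversely, which is impossible in a common orbit since powers
of `ψ` commute (`Higman.DifferentOrbits.complete`). An element with a finite orbit has only finitely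
many images.
-/

/-! ### Descending along a path, and nodes -/

namespace Higman

variable {n r : ℕ}

/-- `x α_{i₁} ⋯ α_{iₖ}` for a path `p = [i₁, …, iₖ]`. -/
def descs {S : Type*} [OmegaAlgebra n S] (p : List (Fin n)) (x : S) : S :=
  p.foldl (fun y i => OmegaAlgebra.desc i y) x

section Descs

variable {S T : Type*}

@[simp]
theorem descs_nil [OmegaAlgebra n S] (x : S) : descs ([] : List (Fin n)) x = x := rfl

@[simp]
theorem descs_cons [OmegaAlgebra n S] (i : Fin n) (p : List (Fin n)) (x : S) :
    descs (i :: p) x = descs p (OmegaAlgebra.desc i x) := rfl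

theorem descs_append [OmegaAlgebra n S] (p q : List (Fin n)) (x : S) :
    descs (p ++ q) x = descs q (descs p x) := List.foldl_append

theorem IsHom.map_descs [OmegaAlgebra n S] [OmegaAlgebra n T] {f : S → T} (hf : IsHom n f)
    (p : List (Fin n)) (x : S) : f (descs p x) = descs p (f x) := by
  induction p generalizing x with
  | nil => rfl
  | cons i p ih => simp [ih, hf.map_desc]

theorem eq_of_forall_desc [VarietyAlgebra n S] {x y : S}
    (h : ∀ i : Fin n, OmegaAlgebra.desc i x = OmegaAlgebra.desc i y) : x = y := by
  rw [← VarietyAlgebra.contr_desc (n := n) x, ← VarietyAlgebra.contr_desc (n := n) y, funext h]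

theorem eq_of_forall_descs [VarietyAlgebra n S] (d : ℕ) {x y : S}
    (h : ∀ p : List (Fin n), p.length = d → descs p x = descs p y) : x = y := by
  induction d generalizing x y with
  | zero => exact h [] rfl
  | succ d ih =>
    exact eq_of_forall_desc fun i => ih fun p hp => h (i :: p) (by simp [hp])

end Descs

/-- `(g, q)` followed by the path `s` is `(g, q ++ s)`. -/
def ext {α β : Type*} (a : α × List β) (s : List β) : α × List β := (a.1, a.2 ++ s)

section Ext

variable {α β : Type*}

@[simp]
theorem ext_nil (a : α × List β) : ext a [] = a := by simp [ext]

theorem ext_append (a : α × List β) (s t : List β) : ext a (s ++ t) = ext (ext a s) t := by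
  simp [ext]

@[simp]
theorem ext_length (a : α × List β) (s : List β) : (ext a s).2.length = a.2.length + s.length := by
  simp [ext]

theorem exists_ext_of_le (a : α × List β) {d : ℕ} (h : d ≤ a.2.length) :
    ∃ (t : α × List β) (s : List β), ext t s = a ∧ t.2.length = d :=
  ⟨(a.1, a.2.take d), a.2.drop d, by simp [ext], by simpa using h⟩

theorem ext_eq_ext {a b : α × List β} {s t : List β} (h : ext a s = ext b t)
    (hl : a.2.length ≤ b.2.length) : ∃ q, b = ext a q ∧ s = q ++ t := by
  obtain ⟨g, p⟩ := a
  obtain ⟨g', p'⟩ := b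
  simp only [ext, Prod.mk.injEq] at h hl ⊢
  obtain ⟨rfl, h⟩ := h
  rcases List.append_eq_append_iff.1 h with ⟨q, rfl, rfl⟩ | ⟨q, rfl, rfl⟩
  · exact ⟨q, ⟨rfl, rfl⟩, rfl⟩
  · obtain rfl : q = [] := by simpa using hl
    exact ⟨[], by simp⟩

end Ext

/-- A node `(g, q)` of the forest of `r` rooted `n`-ary trees; it stands for the element `x_g q` of
`V_{n,r}`. -/
abbrev Node (n r : ℕ) : Type := Fin r × List (Fin n)

/-- The element of `V_{n,r}` at a node. -/
noncomputable def node (a : Node n r) : V n r := descs a.2 (Word.gen a.1).toV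

theorem node_ext (a : Node n r) (s : List (Fin n)) : node (ext a s) = descs s (node a) :=
  descs_append _ _ _

theorem V.induction {P : V n r → Prop} (gen : ∀ g, P (node (g, [])))
    (desc : ∀ (i : Fin n) x, P x → P (OmegaAlgebra.desc i x))
    (contr : ∀ x : Fin n → V n r, (∀ i, P (x i)) → P (OmegaAlgebra.contr x)) (x : V n r) : P x := by
  obtain ⟨w, rfl⟩ := V.exists_word x
  induction w with
  | gen g => exact gen g
  | desc i w ih => rw [← V.desc_toV]; exact desc i _ ih
  | contr w ih => rw [← V.contr_toV]; exact contr _ ih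

/-! ### Distinct nodes are distinct elements -/

/-- Maps from infinite paths to the boundary of the forest. They form an algebra of `𝒱ₙ` in which
a node acts by prefixing, so it separates nodes. -/
def BoundaryMaps (n r : ℕ) : Type := Stream' (Fin n) → Fin r × Stream' (Fin n)

instance (n r : ℕ) : VarietyAlgebra n (BoundaryMaps n r) where
  desc i f z := f (Stream'.cons i z)
  contr f z := f z.head z.tail
  contr_desc f := by
    funext z
    exact congrArg f (Stream'.eta z)
  desc_contr f i := rfl

/-- The value of a word in the algebra of boundary maps, at the standard generators. -/
def Word.boundaryMap : Word n r → BoundaryMaps n r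
  | .gen g => fun z => (g, z)
  | .desc i w => OmegaAlgebra.desc i w.boundaryMap
  | .contr w => OmegaAlgebra.contr fun i => (w i).boundaryMap

theorem Rel.boundaryMap_eq {w w' : Word n r} (h : Rel n r w w') :
    w.boundaryMap = w'.boundaryMap := by
  induction h with
  | refl w => rfl
  | symm _ ih => exact ih.symm
  | trans _ _ ih ih' => exact ih.trans ih'
  | desc i _ ih => simp only [Word.boundaryMap, ih]
  | contr _ ih => simp only [Word.boundaryMap, ih]
  | contr_desc w => exact VarietyAlgebra.contr_desc _
  | desc_contr w i => exact VarietyAlgebra.desc_contr _ i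

/-- The homomorphism from `V_{n,r}` to the algebra of boundary maps. -/
def V.boundaryMap : V n r → BoundaryMaps n r :=
  Quotient.lift Word.boundaryMap fun _ _ h => Rel.boundaryMap_eq h

theorem boundaryMap_node (a : Node n r) (z : Stream' (Fin n)) :
    (node a).boundaryMap z = (a.1, a.2 ++ₛ z) := by
  obtain ⟨g, q⟩ := a
  suffices ∀ x : V n r, (descs q x).boundaryMap z = x.boundaryMap (q ++ₛ z) from this _
  intro x
  induction q generalizing x with
  | nil => rfl
  | cons i q ih =>
    obtain ⟨w, rfl⟩ := V.exists_word x
    rw [descs_cons, ih, V.desc_toV]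
    rfl

theorem append_stream_inj (hn : 2 ≤ n) {p q : List (Fin n)}
    (h : ∀ z : Stream' (Fin n), p ++ₛ z = q ++ₛ z) : p = q := by
  induction p generalizing q with
  | nil =>
    cases q with
    | nil => rfl
    | cons i q =>
      -- a constant stream with a letter other than `i`
      obtain ⟨j, hj⟩ : ∃ j : Fin n, j ≠ i :=
        haveI : Nontrivial (Fin n) := Fin.nontrivial_iff_two_le.2 hn
        exists_ne i
      exact absurd (congrArg Stream'.head (h (Stream'.const j))) hj
  | cons i p ih =>
    cases q with
    | nil =>
      obtain ⟨j, hj⟩ : ∃ j : Fin n, j ≠ i :=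
        haveI : Nontrivial (Fin n) := Fin.nontrivial_iff_two_le.2 hn
        exists_ne i
      exact absurd (congrArg Stream'.head (h (Stream'.const j))).symm hj
    | cons j q =>
      have h1 : i = j := congrArg Stream'.head (h (Stream'.const i))
      rw [h1, ih fun z => congrArg Stream'.tail (h z)]

theorem node_injective (hn : 2 ≤ n) : Function.Injective (node : Node n r → V n r) := by
  rintro ⟨g, p⟩ ⟨g', q⟩ h
  have key (z : Stream' (Fin n)) : (g, p ++ₛ z) = (g', q ++ₛ z) := by
    have := congrArg (fun x => V.boundaryMap x z) h
    simpa only [boundaryMap_node] using this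
  have hg : g = g' := congrArg Prod.fst (key (Stream'.const ⟨0, by omega⟩))
  rw [hg, append_stream_inj hn fun z => congrArg Prod.snd (key z)]

/-! ### The action of an automorphism -/

theorem smul_desc (ψ : G n r) (i : Fin n) (x : V n r) :
    ψ • OmegaAlgebra.desc i x = OmegaAlgebra.desc i (ψ • x) := IsHom.map_desc ψ.2 i x

theorem smul_contr (ψ : G n r) (x : Fin n → V n r) :
    ψ • OmegaAlgebra.contr x = OmegaAlgebra.contr fun i => ψ • x i := IsHom.map_contr ψ.2 x

theorem smul_descs (ψ : G n r) (p : List (Fin n)) (x : V n r) :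
    ψ • descs p x = descs p (ψ • x) := IsHom.map_descs ψ.2 p x

/-- A basis generates `V_{n,r}`. -/
theorem IsBasis.induction {Y : Set (V n r)} (hY : IsBasis Y) {P : V n r → Prop}
    (basis : ∀ y ∈ Y, P y)
    (desc : ∀ (i : Fin n) x, P x → P (OmegaAlgebra.desc i x))
    (contr : ∀ x : Fin n → V n r, (∀ i, P (x i)) → P (OmegaAlgebra.contr x)) (x : V n r) : P x := by
  let _ : VarietyAlgebra n {x // P x} :=
    { desc := fun i x => ⟨OmegaAlgebra.desc i x.1, desc i _ x.2⟩
      contr := fun x => ⟨OmegaAlgebra.contr fun i => (x i).1, contr _ fun i => (x i).2⟩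
      contr_desc := fun x => Subtype.ext (VarietyAlgebra.contr_desc _)
      desc_contr := fun x i => Subtype.ext (VarietyAlgebra.desc_contr _ _) }
  -- the retraction of `V_{n,r}` onto the subalgebra `P` is the identity: both extend `Y → V_{n,r}`
  obtain ⟨f, ⟨hf, hfY⟩, -⟩ := hY {x // P x} fun y => ⟨y, basis y y.2⟩
  obtain ⟨e, -, he⟩ := hY (V n r) fun y => y
  have h1 := he (fun x => (f x).1)
    ⟨⟨fun i w => congrArg Subtype.val (hf.map_desc i w),
      fun w => congrArg Subtype.val (hf.map_contr w)⟩, fun y => congrArg Subtype.val (hfY y)⟩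
  have h2 := he id ⟨⟨fun _ _ => rfl, fun _ => rfl⟩, fun _ => rfl⟩
  have h3 : (f x).1 = x := congrFun (h1.trans h2.symm) x
  exact h3 ▸ (f x).2

end Higman

/-! ### Leaf tables of words -/

namespace Higman

variable {n r : ℕ}

/-- An entry `(p, a)` of the leaf table of an element `x`: it records that `x p` is the node `a`.
Paths and nodes are written with natural numbers, so that they can be computed with. -/
abbrev Leaf : Type := List ℕ × (ℕ × List ℕ)

/-- The leaf table of `x αᵢ`, computed from that of `x`. -/
def descLeaves (i : ℕ) (T : List Leaf) : List Leaf :=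
  T.flatMap fun l =>
    List.casesOn l.1 [([], ext l.2 [i])] fun j p => if j = i then [(p, l.2)] else []

/-- The contribution of `xᵢ` to the leaf table of `(x₁, …, xₙ) lam`. -/
def consLeaves (i : ℕ) (T : List Leaf) : List Leaf := T.map fun l => (i :: l.1, l.2)

/-- The leaf table of a word. -/
def Word.leaves : Word n r → List Leaf
  | .gen g => [([], (g, []))]
  | .desc i w => descLeaves i w.leaves
  | .contr w => (List.ofFn fun i => consLeaves i (w i).leaves).flatten

/-- One step of the stack machine that reads the written form of a word and keeps the leaf tables
of the words that are completed but not yet used as arguments, the latest first. -/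
def leafStep (n : ℕ) (st : List (List Leaf)) : Letter → List (List Leaf)
  | .gen g => [([], (g, []))] :: st
  | .desc i => descLeaves i st.headI :: st.tail
  | .lam => ((List.range n).flatMap fun j => consLeaves j (st.getD (n - 1 - j) [])) :: st.drop n

theorem foldl_leafStep_flatten (ws : List (Word n r))
    (h : ∀ w ∈ ws, ∀ st, w.toRow.foldl (leafStep n) st = w.leaves :: st) (st : List (List Leaf)) :
    (ws.map Word.toRow).flatten.foldl (leafStep n) st = (ws.map Word.leaves).reverse ++ st := by
  induction ws generalizing st with
  | nil => rfl
  | cons w ws ih =>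
    simp [List.foldl_append, h w, ih fun w hw => h w (by simp [hw])]

theorem Word.foldl_leafStep (w : Word n r) (st : List (List Leaf)) :
    w.toRow.foldl (leafStep n) st = w.leaves :: st := by
  induction w generalizing st with
  | gen g => rfl
  | desc i w ih => simp [Word.toRow, List.foldl_append, ih, leafStep, Word.leaves]
  | contr w ih =>
    have hrow : (List.ofFn fun i => (w i).toRow) = (List.ofFn w).map Word.toRow := by
      simp [List.map_ofFn, Function.comp_def]
    have hlen : ((List.ofFn w).map Word.leaves).reverse.length = n := by simp
    rw [Word.toRow, List.foldl_append, hrow, foldl_leafStep_flatten _ (by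
      intro v hv
      obtain ⟨i, rfl⟩ := (List.mem_ofFn' _ _).1 hv
      exact ih i)]
    simp only [List.foldl_cons, List.foldl_nil, leafStep, Word.leaves]
    congr 1
    · rw [List.flatMap]
      congr 1
      refine List.ext_getElem (by simp) fun j h1 h2 => ?_
      have hj : j < n := by simpa using h2
      have hj' : n - 1 - j < n := by omega
      have : n - 1 - (n - 1 - j) = j := by omega
      simp [List.getD_eq_getElem?_getD, List.getElem?_append, hj', this]
    · rw [List.drop_append_of_le_length hlen.ge, List.drop_of_length_le hlen.le, List.nil_append]

/-- The leaf table computed from the written form of a word. -/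
def rowLeaves (n : ℕ) (w : List Letter) : List Leaf := (w.foldl (leafStep n) []).headI

/-- The leaf table of the word written as `w` shows that the element descends along `p` to the
node `a`. -/
def NodeAt (n : ℕ) (w : List Letter) (p : List ℕ) (a : ℕ × List ℕ) : Prop :=
  ∃ l ∈ rowLeaves n w, ∃ s, p = l.1 ++ s ∧ a = ext l.2 s

@[simp]
theorem rowLeaves_toRow (w : Word n r) : rowLeaves n w.toRow = w.leaves := by
  simp [rowLeaves, w.foldl_leafStep]

theorem NodeAt.ext {w : List Letter} {p : List ℕ} {a : ℕ × List ℕ} (h : NodeAt n w p a)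
    (s : List ℕ) : NodeAt n w (p ++ s) (ext a s) := by
  obtain ⟨l, hl, t, rfl, rfl⟩ := h
  exact ⟨l, hl, t ++ s, by simp, by rw [ext_append]⟩

/-! ### Paths and nodes written with natural numbers -/

/-- A path written with natural numbers. -/
def ofPath (p : List (Fin n)) : List ℕ := p.map Fin.val

/-- A node written with natural numbers. -/
def ofNode (a : Node n r) : ℕ × List ℕ := (a.1, ofPath a.2)

/-- The path that a list of natural numbers denotes, the entries being read modulo `n` so that
every list denotes a path. -/
def toPath (n : ℕ) [NeZero n] (p : List ℕ) : List (Fin n) := p.map (Fin.ofNat n)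

/-- The node that a pair written with natural numbers denotes, the entries being read modulo `r`
and `n`. -/
def toNode (n r : ℕ) [NeZero n] [NeZero r] (a : ℕ × List ℕ) : Node n r :=
  (Fin.ofNat r a.1, toPath n a.2)

theorem ofPath_append (p q : List (Fin n)) : ofPath (p ++ q) = ofPath p ++ ofPath q :=
  List.map_append

theorem ofNode_ext (a : Node n r) (s : List (Fin n)) :
    ofNode (ext a s) = ext (ofNode a) (ofPath s) := by
  simp [ofNode, ext, ofPath_append]

@[simp]
theorem ofPath_length (p : List (Fin n)) : (ofPath p).length = p.length := List.length_map _

theorem ofNode_injective : Function.Injective (ofNode : Node n r → ℕ × List ℕ) := by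
  rintro ⟨g, p⟩ ⟨h, q⟩ e
  simp only [ofNode, Prod.mk.injEq, Fin.val_inj, ofPath] at e
  rw [e.1, List.map_injective_iff.2 Fin.val_injective e.2]

section NeZero

variable [NeZero n] [NeZero r]

@[simp]
theorem toPath_append (p q : List ℕ) : toPath n (p ++ q) = toPath n p ++ toPath n q :=
  List.map_append

@[simp]
theorem toPath_length (p : List ℕ) : (toPath n p).length = p.length := List.length_map _

@[simp]
theorem toNode_ext (a : ℕ × List ℕ) (s : List ℕ) :
    toNode n r (ext a s) = ext (toNode n r a) (toPath n s) := by
  simp [toNode, ext]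

@[simp]
theorem toPath_ofPath (p : List (Fin n)) : toPath n (ofPath p) = p := by
  simp [toPath, ofPath, Function.comp_def]

@[simp]
theorem toNode_ofNode (a : Node n r) : toNode n r (ofNode a) = a := by
  simp [toNode, ofNode]

end NeZero

/-! ### Leaf tables are sound and complete -/

theorem Word.leaves_sound [NeZero n] [NeZero r] (w : Word n r) :
    ∀ l ∈ w.leaves, descs (toPath n l.1) w.toV = node (toNode n r l.2) := by
  induction w with
  | gen g =>
    intro l hl
    obtain rfl : l = ([], ((g : ℕ), [])) := by simpa [Word.leaves] using hl
    exact congrArg node (toNode_ofNode (g, [])).symm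
  | desc i w ih =>
    rintro l hl
    simp only [Word.leaves, descLeaves, List.mem_flatMap] at hl
    obtain ⟨⟨p, a⟩, hpa, hl⟩ := hl
    have key := ih _ hpa
    cases p with
    | nil =>
      obtain rfl : l = ([], Higman.ext a [(i : ℕ)]) := by simpa using hl
      change _ = node _ at key
      change (Word.desc i w).toV = _
      rw [toNode_ext, node_ext, ← key, ← V.desc_toV]
      simp [toPath]
    | cons j p =>
      by_cases hj : j = i
      · obtain rfl : l = (p, a) := by simpa [hj] using hl
        rw [← key, hj, ← V.desc_toV]
        simp [toPath]
      · simp [hj] at hl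
  | contr w ih =>
    intro l hl
    simp only [Word.leaves, List.mem_flatten, List.mem_ofFn', Set.mem_range] at hl
    obtain ⟨_, ⟨i, rfl⟩, hl⟩ := hl
    obtain ⟨l', hl', rfl⟩ := List.mem_map.1 hl
    rw [← ih i l' hl', ← V.contr_toV]
    simp [toPath, VarietyAlgebra.desc_contr]

theorem Word.leaves_complete (w : Word n r) :
    ∃ D, ∀ p : List (Fin n), D ≤ p.length →
      ∃ l ∈ w.leaves, ∃ (s : List (Fin n)) (a : Node n r),
        ofPath p = l.1 ++ ofPath s ∧ l.2 = ofNode a := by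
  induction w with
  | gen g =>
    exact ⟨0, fun p _ => ⟨([], ((g : ℕ), [])), by simp [Word.leaves], p, (g, []), rfl, rfl⟩⟩
  | desc i w ih =>
    obtain ⟨D, hD⟩ := ih
    refine ⟨D, fun p hp => ?_⟩
    obtain ⟨⟨q, _⟩, hl, s, a, h1, rfl⟩ := hD (i :: p) (by simp; omega)
    cases q with
    | nil =>
      refine ⟨([], ofNode (Higman.ext a [i])), ?_, p, _, rfl, rfl⟩
      refine List.mem_flatMap.2 ⟨_, hl, ?_⟩
      simp [ofNode_ext, ofPath]
    | cons j q =>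
      simp only [ofPath, List.map_cons, List.cons_append, List.cons.injEq] at h1
      refine ⟨(q, ofNode a), List.mem_flatMap.2 ⟨_, hl, ?_⟩, s, a, h1.2, rfl⟩
      simp [h1.1]
  | contr w ih =>
    choose D hD using ih
    refine ⟨Finset.univ.sup D + 1, fun p hp => ?_⟩
    cases p with
    | nil => simp at hp
    | cons i p =>
      have hi : D i ≤ Finset.univ.sup D := Finset.le_sup (Finset.mem_univ i)
      obtain ⟨l, hl, s, a, h1, h2⟩ := hD i p (by rw [List.length_cons] at hp; omega)
      refine ⟨(i :: l.1, l.2), ?_, s, a, by simpa [ofPath] using h1, h2⟩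
      simp only [Word.leaves, List.mem_flatten, List.mem_ofFn', Set.mem_range]
      exact ⟨_, ⟨i, rfl⟩, List.mem_map.2 ⟨l, hl, rfl⟩⟩

theorem NodeAt.sound [NeZero n] [NeZero r] {w : Word n r} {p : List ℕ} {a : ℕ × List ℕ}
    (h : NodeAt n w.toRow p a) : descs (toPath n p) w.toV = node (toNode n r a) := by
  obtain ⟨l, hl, s, rfl, rfl⟩ := h
  rw [rowLeaves_toRow] at hl
  rw [toPath_append, descs_append, w.leaves_sound l hl, toNode_ext, node_ext]

/-- Every element descends to deep nodes along all long paths. -/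
theorem NodeAt.complete (w : Word n r) (e : ℕ) :
    ∃ D, ∀ p : List (Fin n), D ≤ p.length →
      ∃ a : Node n r, NodeAt n w.toRow (ofPath p) (ofNode a) ∧ e ≤ a.2.length := by
  obtain ⟨D, hD⟩ := w.leaves_complete
  refine ⟨D + e, fun p hp => ?_⟩
  obtain ⟨l, hl, s, a, h1, h2⟩ := hD (p.take D) (by simp; omega)
  refine ⟨Higman.ext (Higman.ext a s) (p.drop D),
    ⟨l, by rwa [rowLeaves_toRow], ofPath s ++ ofPath (p.drop D), ?_, ?_⟩, ?_⟩
  · rw [← List.append_assoc, ← h1, ← ofPath_append, List.take_append_drop]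
  · rw [ofNode_ext, ofNode_ext, h2, ext_append]
  · simp
    omega

end Higman

/-! ### Iterated relations -/

namespace Higman

/-- `b` is reached from `a` by `m` steps of the relation `R`. -/
def Steps {α : Type*} (R : α → α → Prop) : ℕ → α → α → Prop
  | 0, a, b => a = b
  | m + 1, a, c => ∃ b, R a b ∧ Steps R m b c

section Steps

variable {α β : Type*} {R : α → α → Prop}

theorem Steps.trans {m k : ℕ} {a b c : α} (h : Steps R m a b) (h' : Steps R k b c) :
    Steps R (m + k) a c := by
  induction m generalizing a with
  | zero => obtain rfl := h; simpa using h'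
  | succ m ih =>
    obtain ⟨a', ha, h⟩ := h
    rw [Nat.add_right_comm]
    exact ⟨a', ha, ih h⟩

theorem Steps.flip {m : ℕ} {a b : α} (h : Steps R m a b) : Steps (flip R) m b a := by
  induction m generalizing a with
  | zero => exact Eq.symm h
  | succ m ih =>
    obtain ⟨a', ha, h⟩ := h
    exact (ih h).trans ⟨a, ha, rfl⟩

theorem Steps.map {S : β → β → Prop} {f : α → β} (hf : ∀ a b, R a b → S (f a) (f b)) {m : ℕ}
    {a b : α} (h : Steps R m a b) : Steps S m (f a) (f b) := by
  induction m generalizing a with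
  | zero => exact congrArg f h
  | succ m ih =>
    obtain ⟨a', ha, h⟩ := h
    exact ⟨f a', hf _ _ ha, ih h⟩

theorem Steps.smul_eq {M : Type*} [Group M] [MulAction M β] {g : M} {f : α → β}
    (hf : ∀ a b, R a b → g • f a = f b) {m : ℕ} {a b : α} (h : Steps R m a b) :
    g ^ m • f a = f b := by
  induction m generalizing a with
  | zero => simpa using congrArg f h
  | succ m ih =>
    obtain ⟨a', ha, h⟩ := h
    rw [pow_succ, mul_smul, hf _ _ ha, ih h]

/-- The form of `Steps` over which one can search: a list of the intermediate points. -/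
theorem steps_iff_exists_list {m : ℕ} {a b : α} :
    Steps R m a b ↔ ∃ l : List α, l[0]? = some a ∧ l[m]? = some b ∧
      ∀ i < m, ∃ x y, l[i]? = some x ∧ l[i + 1]? = some y ∧ R x y := by
  induction m generalizing a with
  | zero =>
    constructor
    · rintro rfl
      exact ⟨[a], rfl, rfl, by simp⟩
    · rintro ⟨l, h1, h2, -⟩
      exact Option.some.inj (h1.symm.trans h2)
  | succ m ih =>
    constructor
    · rintro ⟨a', ha, h⟩
      obtain ⟨l, h1, h2, h3⟩ := ih.1 h
      refine ⟨a :: l, rfl, by simpa using h2, fun i hi => ?_⟩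
      cases i with
      | zero => exact ⟨a, a', rfl, by simpa using h1, ha⟩
      | succ i => simpa using h3 i (by omega)
    · rintro ⟨l, h1, h2, h3⟩
      obtain ⟨x, y, hx, hy, hxy⟩ := h3 0 (by omega)
      obtain rfl : a = x := Option.some.inj (h1.symm.trans hx)
      refine ⟨y, hxy, ih.2 ⟨l.tail, by simpa using hy, by simpa using h2, fun i hi => ?_⟩⟩
      simpa using h3 (i + 1) (by omega)

end Steps

/-! ### Known values of an automorphism at nodes -/

variable {n r : ℕ}

/-- The pair of nodes `(a, b)` is found among the descendants of a pair in the list `L`. -/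
def Fact (n : ℕ) (L : List (List Letter × List Letter)) (a b : ℕ × List ℕ) : Prop :=
  ∃ y ∈ L, ∃ p, NodeAt n y.1 p a ∧ NodeAt n y.2 p b

/-- The written form of a list of pairs of words. -/
def rows (L : List (Word n r × Word n r)) : List (List Letter × List Letter) :=
  L.map fun p => (p.1.toRow, p.2.toRow)

theorem Fact.ext {L : List (List Letter × List Letter)} {a b : ℕ × List ℕ} (h : Fact n L a b)
    (s : List ℕ) : Fact n L (ext a s) (ext b s) := by
  obtain ⟨y, hy, p, h1, h2⟩ := h
  exact ⟨y, hy, p ++ s, h1.ext s, h2.ext s⟩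

theorem Describes.smul_node [NeZero n] [NeZero r] {L : List (Word n r × Word n r)} {ψ : G n r}
    (hL : Describes L ψ) {a b : ℕ × List ℕ} (h : Fact n (rows L) a b) :
    ψ • node (toNode n r a) = node (toNode n r b) := by
  obtain ⟨y, hy, p, h1, h2⟩ := h
  obtain ⟨y, hyL, rfl⟩ := List.mem_map.1 hy
  rw [← h1.sound, ← h2.sound, smul_descs]
  exact congrArg _ (hL.2 y hyL)

/-- The relation `F` between nodes is part of the graph of `ψ`, and is defined at all deep nodes. -/
structure Tracks (ψ : G n r) (F : Node n r → Node n r → Prop) : Prop where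
  smul_node : ∀ {a b}, F a b → ψ • node a = node b
  ext : ∀ {a b} s, F a b → F (ext a s) (ext b s)
  total : ∃ D, ∀ a : Node n r, D ≤ a.2.length → ∃ b, F a b

theorem exists_fact (hn : 2 ≤ n) [NeZero r] (L : List (Word n r × Word n r))
    (hL : ∀ P : V n r → Prop, (∀ y ∈ L, P y.1.toV) →
      (∀ (i : Fin n) x, P x → P (OmegaAlgebra.desc i x)) →
      (∀ x : Fin n → V n r, (∀ i, P (x i)) → P (OmegaAlgebra.contr x)) → ∀ x, P x) :
    ∃ D, ∀ a : Node n r, D ≤ a.2.length →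
      ∃ b : Node n r, Fact n (rows L) (ofNode a) (ofNode b) := by
  have : NeZero n := ⟨by omega⟩
  choose D hD using fun w : Word n r => NodeAt.complete w 0
  let d := (L.map fun y => max (D y.1) (D y.2)).sum
  have hd (y) (hy : y ∈ L) : max (D y.1) (D y.2) ≤ d :=
    List.le_sum_of_mem (List.mem_map.2 ⟨y, hy, rfl⟩)
  -- all elements descend to deep descendants of the words on the left, as those generate
  have key := hL (fun x => ∃ e, ∀ p : List (Fin n), e ≤ p.length →
      ∃ y ∈ L, ∃ q : List (Fin n), d ≤ q.length ∧ descs p x = descs q y.1.toV)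
    (fun y hy => ⟨d, fun p hp => ⟨y, hy, p, hp, rfl⟩⟩)
    (fun i x ⟨e, he⟩ => ⟨e, fun p hp => he (i :: p) (by simp; omega)⟩)
    (fun x hx => by
      choose e he using hx
      refine ⟨Finset.univ.sup e + 1, fun p hp => ?_⟩
      cases p with
      | nil => simp at hp
      | cons i p =>
        have hi : e i ≤ Finset.univ.sup e := Finset.le_sup (Finset.mem_univ i)
        rw [descs_cons, VarietyAlgebra.desc_contr]
        exact he i p (by rw [List.length_cons] at hp; omega))
  choose e he using fun g : Fin r => key (node (g, []))
  refine ⟨Finset.univ.sup e, fun a ha => ?_⟩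
  have hi : e a.1 ≤ Finset.univ.sup e := Finset.le_sup (Finset.mem_univ _)
  obtain ⟨y, hy, q, hq, h⟩ := he a.1 a.2 (hi.trans ha)
  have hy' := hd y hy
  obtain ⟨a', ha', -⟩ := hD y.1 q (by omega)
  obtain ⟨b, hb, -⟩ := hD y.2 q (by omega)
  have hs := ha'.sound
  simp only [toPath_ofPath, toNode_ofNode] at hs
  obtain rfl : a' = a := node_injective hn (by rw [← hs, ← h]; rfl)
  exact ⟨b, _, List.mem_map.2 ⟨y, hy, rfl⟩, _, ha', hb⟩

/-- The known values of `ψ` at nodes. -/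
def nodeFact (L : List (Word n r × Word n r)) (a b : Node n r) : Prop :=
  Fact n (rows L) (ofNode a) (ofNode b)

theorem Describes.smul_nodeFact [NeZero n] [NeZero r] {L : List (Word n r × Word n r)} {ψ : G n r}
    (hL : Describes L ψ) {a b : Node n r} (h : nodeFact L a b) : ψ • node a = node b := by
  simpa using hL.smul_node h

theorem nodeFact.ext {L : List (Word n r × Word n r)} {a b : Node n r} (h : nodeFact L a b)
    (s : List (Fin n)) : nodeFact L (ext a s) (ext b s) := by
  simpa [nodeFact, ofNode_ext] using Fact.ext h (ofPath s)

theorem Describes.tracks (hn : 2 ≤ n) [NeZero r] {L : List (Word n r × Word n r)} {ψ : G n r}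
    (hL : Describes L ψ) : Tracks ψ (nodeFact L) where
  smul_node h :=
    have : NeZero n := ⟨by omega⟩
    hL.smul_nodeFact h
  ext s h := h.ext s
  total := exists_fact hn L fun P h1 h2 h3 =>
    hL.1.induction (by rintro _ ⟨y, hy, rfl⟩; exact h1 y hy) h2 h3

/-- The images of a basis under `ψ` generate too, so the known values determine `ψ⁻¹` as well. -/
theorem Describes.tracks_inv (hn : 2 ≤ n) [NeZero r] {L : List (Word n r × Word n r)} {ψ : G n r}
    (hL : Describes L ψ) : Tracks ψ⁻¹ (flip (nodeFact L)) where
  smul_node h := by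
    have : NeZero n := ⟨by omega⟩
    rw [inv_smul_eq_iff, hL.smul_nodeFact h]
  ext s h := nodeFact.ext h s
  total := by
    obtain ⟨D, hD⟩ := exists_fact hn (L.map Prod.swap) fun P h1 h2 h3 x => by
      have key := hL.1.induction (P := fun x => P (ψ • x))
        (by
          rintro _ ⟨y, hy, rfl⟩
          have := h1 y.swap (List.mem_map.2 ⟨y, hy, rfl⟩)
          rwa [Prod.fst_swap, ← hL.2 y hy] at this)
        (fun i x hx => by rw [smul_desc]; exact h2 i _ hx)
        (fun x hx => by rw [smul_contr]; exact h3 _ hx) (ψ⁻¹ • x)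
      rwa [smul_inv_smul] at key
    refine ⟨D, fun a ha => ?_⟩
    obtain ⟨b, y, hy, p, h1, h2⟩ := hD a ha
    obtain ⟨_, hz, rfl⟩ := List.mem_map.1 hy
    obtain ⟨z, hz', rfl⟩ := List.mem_map.1 hz
    exact ⟨b, _, List.mem_map.2 ⟨z, hz', rfl⟩, p, h2, h1⟩

namespace Tracks

variable {ψ : G n r} {F : Node n r → Node n r → Prop}

theorem smul_steps (h : Tracks ψ F) {m : ℕ} {a b : Node n r} (hs : Steps F m a b) :
    ψ ^ m • node a = node b :=
  hs.smul_eq (f := node) fun _ _ => h.smul_node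

/-- The powers of `ψ` are known at all deep nodes. -/
theorem steps_total (h : Tracks ψ F) (m : ℕ) :
    ∃ D, ∀ a : Node n r, D ≤ a.2.length → ∃ b, Steps F m a b := by
  obtain ⟨D, hD⟩ := h.total
  induction m with
  | zero => exact ⟨0, fun a _ => ⟨a, rfl⟩⟩
  | succ m ih =>
    obtain ⟨E, hE⟩ := ih
    refine ⟨D + E, fun a ha => ?_⟩
    obtain ⟨t, s, rfl, ht⟩ := exists_ext_of_le a (d := D) (by omega)
    obtain ⟨b, hb⟩ := hD t ht.ge
    obtain ⟨c, hc⟩ := hE (Higman.ext b s) (by simp at ha ⊢; omega)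
    exact ⟨c, _, h.ext s hb, hc⟩

end Tracks

end Higman

/-! ### Periodic elements -/

namespace Higman

variable {n r : ℕ}

/-- The `ψ`-orbit of `x` is finite. -/
def IsPeriodic (ψ : G n r) (x : V n r) : Prop := ∃ k, 0 < k ∧ ψ ^ k • x = x

theorem IsPeriodic.descs {ψ : G n r} {x : V n r} (h : IsPeriodic ψ x) (p : List (Fin n)) :
    IsPeriodic ψ (descs p x) := by
  obtain ⟨k, hk, h⟩ := h
  exact ⟨k, hk, by rw [smul_descs, h]⟩

theorem IsPeriodic.of_pow_smul {ψ : G n r} {x : V n r} {m : ℕ} (h : IsPeriodic ψ (ψ ^ m • x)) :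
    IsPeriodic ψ x := by
  obtain ⟨k, hk, h⟩ := h
  refine ⟨k, hk, MulAction.injective (ψ ^ m) ?_⟩
  dsimp only
  rw [smul_smul, ← pow_add, add_comm, pow_add, mul_smul, h]

theorem isPeriodic_of_forall_desc {ψ : G n r} {x : V n r}
    (h : ∀ i : Fin n, IsPeriodic ψ (OmegaAlgebra.desc i x)) : IsPeriodic ψ x := by
  choose k hk h using h
  refine ⟨∏ i, k i, Finset.prod_pos fun i _ => hk i, eq_of_forall_desc (n := n) fun i => ?_⟩
  obtain ⟨c, hc⟩ := Finset.dvd_prod_of_mem k (Finset.mem_univ i)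
  rw [← smul_desc, hc, pow_mul]
  have (c : ℕ) : (ψ ^ k i) ^ c • OmegaAlgebra.desc i x = OmegaAlgebra.desc i x := by
    induction c with
    | zero => simp
    | succ c ih => rw [pow_succ, mul_smul, h i, ih]
  exact this c

/-- By compactness: an element with infinite orbit has descendants with infinite orbits along an
infinite path, of which `P j` is the beginning of length `j`. -/
theorem exists_path_not_isPeriodic {ψ : G n r} {x : V n r} (hx : ¬IsPeriodic ψ x) :
    ∃ P : ℕ → List (Fin n), (∀ j, ¬IsPeriodic ψ (descs (P j) x)) ∧ (∀ j, (P j).length = j) ∧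
      ∀ i j, i ≤ j → P i <+: P j := by
  have step (p : {p : List (Fin n) // ¬IsPeriodic ψ (descs p x)}) :
      ∃ i : Fin n, ¬IsPeriodic ψ (descs (p.1 ++ [i]) x) := by
    by_contra! h
    refine p.2 (isPeriodic_of_forall_desc fun i => ?_)
    simpa [descs_append] using h i
  choose c hc using step
  let Q (j : ℕ) : {p : List (Fin n) // ¬IsPeriodic ψ (descs p x)} :=
    Nat.rec ⟨[], hx⟩ (fun _ p => ⟨p.1 ++ [c p], hc p⟩) j
  refine ⟨fun j => (Q j).1, fun j => (Q j).2, fun j => ?_, fun i j hij => ?_⟩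
  · induction j with
    | zero => rfl
    | succ j ih => exact (List.length_append ..).trans (congrArg (· + 1) ih)
  · induction j, hij using Nat.le_induction with
    | base => exact List.prefix_rfl
    | succ j _ ih => exact ih.trans (List.prefix_append _ _)

/-! ### Elements with infinite orbits -/

theorem finite_setOf_node_length_le (D : ℕ) : {a : Node n r | a.2.length ≤ D}.Finite :=
  (Set.finite_univ.prod (List.finite_length_le (Fin n) D)).subset fun _ ha => ⟨trivial, ha⟩

theorem exists_node (x : V n r) (e : ℕ) :
    ∃ D, ∀ p : List (Fin n), D ≤ p.length →
      ∃ a : Node n r, descs p x = node a ∧ e ≤ a.2.length := by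
  rcases Nat.eq_zero_or_pos n with rfl | hn
  · refine ⟨1, fun p hp => ?_⟩
    cases p with
    | nil => simp at hp
    | cons i => exact i.elim0
  have : NeZero n := ⟨hn.ne'⟩
  obtain ⟨w, rfl⟩ := V.exists_word x
  obtain ⟨D, hD⟩ := NodeAt.complete w e
  refine ⟨D, fun p hp => ?_⟩
  obtain ⟨a, ha, he⟩ := hD p hp
  have : NeZero r := ⟨a.1.pos.ne'⟩
  exact ⟨a, by simpa using ha.sound, he⟩

/-- The orbit of the node `a` reaches a node `t s` such that `k` steps take `t` to a proper
descendant `t Γ`. From then on it goes through the nodes `t Γ s`, `t Γ Γ s`, … -/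
def Grows (F : Node n r → Node n r → Prop) (a : Node n r) : Prop :=
  ∃ M k t s Γ, Γ ≠ [] ∧ Steps F M a (ext t s) ∧ Steps F k t (ext t Γ)

theorem steps_iterate {α : Type*} {R : α → α → Prop} {f : α → α} {m : ℕ} {a : α}
    (h : ∀ i < m, R (f^[i] a) (f (f^[i] a))) : Steps R m a (f^[m] a) := by
  induction m generalizing a with
  | zero => rfl
  | succ m ih =>
    exact ⟨f a, h 0 (by omega), ih fun i hi => by
      rw [← Function.iterate_succ_apply]; exact h (i + 1) (by omega)⟩

theorem exists_forall_le_of_ge (l : ℕ → ℕ) (N : ℕ) : ∃ m, N ≤ m ∧ ∀ m' ≥ m, l m ≤ l m' := by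
  classical
  have hex : ∃ k, ∃ m, N ≤ m ∧ l m = k := ⟨_, N, le_rfl, rfl⟩
  obtain ⟨m, hm, h⟩ := Nat.find_spec hex
  exact ⟨m, hm, fun m' hm' => h ▸ Nat.find_min' hex ⟨m', hm.trans hm', rfl⟩⟩

section Iterate

variable {f : Node n r → Node n r} {D : ℕ}

theorem iterate_ext
    (hf : ∀ a : Node n r, D ≤ a.2.length → ∀ s, f (ext a s) = ext (f a) s) {t : Node n r}
    {m : ℕ} (h : ∀ i < m, D ≤ (f^[i] t).2.length) (s : List (Fin n)) :
    f^[m] (ext t s) = ext (f^[m] t) s := by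
  induction m generalizing t with
  | zero => rfl
  | succ m ih =>
    rw [Function.iterate_succ_apply, hf t (h 0 (by omega)), ih fun i hi => by
      rw [← Function.iterate_succ_apply]; exact h (i + 1) (by omega)]
    rfl

/-- If the orbit of a node stays deep, consider the times from which on it is never less deep
than then. After such a time, only the part of the node of length `D` next to the root takes part
in the motion. As there are finitely many such parts, one of them recurs. -/
theorem isPeriodic_or_grows_of_forall_le {ψ : G n r} {F : Node n r → Node n r → Prop}
    (h : Tracks ψ F) (hF : ∀ a : Node n r, D ≤ a.2.length → F a (f a))
    (hf : ∀ a : Node n r, D ≤ a.2.length → ∀ s, f (ext a s) = ext (f a) s)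
    {a : Node n r} (ha : ∀ m, D ≤ (f^[m] a).2.length) : IsPeriodic ψ (node a) ∨ Grows F a := by
  choose t s hts ht using fun m => exists_ext_of_le (f^[m] a) (ha m)
  let T : Set ℕ := {m | ∀ m' ≥ m, (f^[m] a).2.length ≤ (f^[m'] a).2.length}
  have hinf : T.Infinite := by
    refine Set.infinite_of_forall_exists_gt fun N => ?_
    obtain ⟨m, hm, h⟩ := exists_forall_le_of_ge (fun m => (f^[m] a).2.length) (N + 1)
    exact ⟨m, h, hm⟩
  obtain ⟨m, hm, m', -, hlt, heq⟩ : ∃ m ∈ T, ∃ m' ∈ T, m < m' ∧ t m = t m' :=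
    hinf.exists_lt_map_eq_of_mapsTo (t := {a : Node n r | a.2.length ≤ D})
      (fun m _ => (ht m).le) (finite_setOf_node_length_le D)
  have hdeep (i : ℕ) : D ≤ (f^[i] (t m)).2.length := by
    induction i using Nat.strong_induction_on with
    | _ i ih =>
      have h1 := hm (m + i) (by omega)
      rw [add_comm, Function.iterate_add_apply, ← hts m, iterate_ext hf ih, ext_length, ext_length,
        ht m] at h1
      omega
  obtain ⟨k, rfl⟩ := Nat.exists_eq_add_of_lt hlt
  have h1 := hts (m + k + 1)
  rw [add_assoc, add_comm, Function.iterate_add_apply, ← hts m, iterate_ext hf fun i _ => hdeep i,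
    add_comm, ← add_assoc, ← heq] at h1
  obtain ⟨Γ, hΓ, -⟩ := ext_eq_ext h1 ((ht m).trans_le (hdeep _))
  have h2 : Steps F (k + 1) (t m) (ext (t m) Γ) := hΓ ▸ steps_iterate fun i _ => hF _ (hdeep i)
  have h3 : Steps F m a (ext (t m) (s m)) := hts m ▸ steps_iterate fun i _ => hF _ (ha i)
  by_cases hΓ0 : Γ = []
  · left
    have h4 : IsPeriodic ψ (node (t m)) := ⟨k + 1, by omega, by simpa [hΓ0] using h.smul_steps h2⟩
    apply IsPeriodic.of_pow_smul (m := m)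
    rw [h.smul_steps h3, node_ext]
    exact h4.descs _
  · exact Or.inr ⟨m, k + 1, t m, s m, Γ, hΓ0, h3, h2⟩

end Iterate

/-- An element with infinite orbit has a descendant that grows, or one that some power of `ψ` takes
to a proper descendant or to a proper ancestor. -/
theorem Tracks.exists_grows_or_hyperbolic (hn : 2 ≤ n) {ψ : G n r}
    {F : Node n r → Node n r → Prop} (h : Tracks ψ F) {x : V n r} (hx : ¬IsPeriodic ψ x) :
    ∃ p : List (Fin n), (∃ a, descs p x = node a ∧ Grows F a) ∨
      ∃ (k : ℕ) (Γ : List (Fin n)), Γ ≠ [] ∧ (ψ ^ k • descs p x = descs Γ (descs p x) ∨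
        ψ ^ k • descs Γ (descs p x) = descs p x) := by
  obtain ⟨D, hD⟩ := h.total
  choose! f hF using hD
  have hf (a : Node n r) (ha : D ≤ a.2.length) (s) : f (Higman.ext a s) = Higman.ext (f a) s := by
    apply node_injective hn
    rw [← h.smul_node (hF _ (by simp; omega)), ← h.smul_node (h.ext s (hF a ha))]
  obtain ⟨P, hP, hPlen, hPpre⟩ := exists_path_not_isPeriodic hx
  obtain ⟨E, hE⟩ := exists_node x D
  choose a ha haD using fun j => hE (P (E + j)) (by simp [hPlen])
  by_cases hcase : ∃ j, ∀ m, D ≤ (f^[m] (a j)).2.length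
  · obtain ⟨j, hj⟩ := hcase
    rcases isPeriodic_or_grows_of_forall_le h hF hf hj with h1 | h1
    · exact absurd (ha j ▸ h1) (hP _)
    · exact ⟨_, Or.inl ⟨a j, ha j, h1⟩⟩
  -- all the nodes `a j` become short at some time, and two of them then agree
  have hshort (j : ℕ) : ∃ m c, c.2.length ≤ D ∧ Steps F m (a j) c := by
    have : ∃ m, (f^[m] (a j)).2.length < D := by simpa using not_exists.1 hcase j
    classical
    exact ⟨Nat.find this, _, (Nat.find_spec this).le,
      steps_iterate fun i hi => hF _ (not_lt.1 (Nat.find_min this hi))⟩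
  choose m c hc hs using hshort
  obtain ⟨i, -, j, -, hij, hcc⟩ : ∃ i ∈ Set.univ, ∃ j ∈ Set.univ, i < j ∧ c i = c j :=
    Set.infinite_univ.exists_lt_map_eq_of_mapsTo (fun m _ => hc m) (finite_setOf_node_length_le D)
  obtain ⟨Γ, hΓ⟩ := hPpre (E + i) (E + j) (by omega)
  have hΓ0 : Γ ≠ [] := by
    rintro rfl
    have := congrArg List.length hΓ
    simp [hPlen] at this
    omega
  have key : ψ ^ m i • descs (P (E + i)) x = ψ ^ m j • descs Γ (descs (P (E + i)) x) := by
    rw [← descs_append, hΓ, ha, ha, h.smul_steps (hs i), h.smul_steps (hs j), hcc]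
  refine ⟨P (E + i), Or.inr ?_⟩
  rcases le_total (m i) (m j) with hm | hm
  · obtain ⟨k, hk⟩ := Nat.exists_eq_add_of_le hm
    refine ⟨k, Γ, hΓ0, Or.inr (MulAction.injective (ψ ^ m i) ?_)⟩
    dsimp only
    rw [key, hk, pow_add, mul_smul]
  · obtain ⟨k, hk⟩ := Nat.exists_eq_add_of_le hm
    refine ⟨k, Γ, hΓ0, Or.inl (MulAction.injective (ψ ^ m j) ?_)⟩
    dsimp only
    rw [← key, hk, pow_add, mul_smul]

/-- The element `x` has a descendant at a node that grows. -/
def HasGrowth (F : Node n r → Node n r → Prop) (x : V n r) : Prop :=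
  ∃ (p : List (Fin n)) (a : Node n r), descs p x = node a ∧ Grows F a

theorem HasGrowth.of_descs {F : Node n r → Node n r → Prop} {x : V n r} {p : List (Fin n)}
    (h : HasGrowth F (descs p x)) : HasGrowth F x := by
  obtain ⟨q, a, hq, ha⟩ := h
  exact ⟨p ++ q, a, by rw [descs_append, hq], ha⟩

theorem Tracks.hasGrowth_of_smul_eq_descs (hn : 2 ≤ n) {ψ : G n r}
    {F : Node n r → Node n r → Prop} (h : Tracks ψ F) {x : V n r} {k : ℕ} {Γ : List (Fin n)}
    (hΓ : Γ ≠ []) (hx : ψ ^ k • x = descs Γ x) : HasGrowth F x := by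
  obtain ⟨D, hD⟩ := h.steps_total k
  obtain ⟨E, hE⟩ := exists_node x D
  -- the descendant of `x` along a high power of `Γ` behaves like `x` and is a deep node
  let q := (List.replicate E Γ).flatten
  have hq : E ≤ q.length := by
    simpa [q] using Nat.le_mul_of_pos_right E (List.length_pos_of_ne_nil hΓ)
  have hcomm : Γ ++ q = q ++ Γ := by
    have h1 : (List.replicate (E + 1) Γ).flatten = Γ ++ q := by simp [List.replicate_succ, q]
    have h2 : (List.replicate (E + 1) Γ).flatten = q ++ Γ := by simp [List.replicate_succ', q]
    exact h1.symm.trans h2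
  obtain ⟨a, ha, haD⟩ := hE q hq
  obtain ⟨b, hb⟩ := hD a haD
  have : b = Higman.ext a Γ := by
    apply node_injective hn
    rw [← h.smul_steps hb, ← ha, smul_descs, hx, ← descs_append, hcomm, descs_append, ha, node_ext]
  exact ⟨q, a, ha, 0, k, a, [], Γ, hΓ, (ext_nil a).symm, this ▸ hb⟩

theorem Tracks.hasGrowth_of_smul_descs_eq (hn : 2 ≤ n) {ψ : G n r}
    {F : Node n r → Node n r → Prop} (h : Tracks ψ⁻¹ F) {x : V n r} {k : ℕ} {Γ : List (Fin n)}
    (hΓ : Γ ≠ []) (hx : ψ ^ k • descs Γ x = x) : HasGrowth F x :=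
  h.hasGrowth_of_smul_eq_descs hn (k := k) hΓ (by rw [inv_pow, inv_smul_eq_iff, hx])

end Higman

/-! ### Certificates -/

namespace Higman

variable {n r : ℕ}

/-- The paths of length `d`, written with natural numbers. -/
def paths (n : ℕ) : ℕ → List (List ℕ)
  | 0 => [[]]
  | d + 1 => (List.range n).flatMap fun i => (paths n d).map fun p => i :: p

theorem mem_paths {d : ℕ} {p : List ℕ} :
    p ∈ paths n d ↔ ∃ q : List (Fin n), q.length = d ∧ ofPath q = p := by
  induction d generalizing p with
  | zero =>
    simp only [paths, List.mem_singleton, List.length_eq_zero_iff, exists_eq_left]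
    exact eq_comm
  | succ d ih =>
    simp only [paths, List.mem_flatMap, List.mem_range, List.mem_map, ih]
    constructor
    · rintro ⟨i, hi, _, ⟨q, hq, rfl⟩, rfl⟩
      exact ⟨⟨i, hi⟩ :: q, by simp [hq], rfl⟩
    · rintro ⟨q, hq, rfl⟩
      cases q with
      | nil => simp at hq
      | cons i q => exact ⟨i, i.2, _, ⟨q, by simpa using hq, rfl⟩, rfl⟩

/-- The entries of a node reduced modulo `r` and `n`. As lists of numbers are read with entries
modulo `r` and `n`, two of them denote different nodes if these reductions differ. -/
def reduce (n r : ℕ) (a : ℕ × List ℕ) : ℕ × List ℕ := (a.1 % r, a.2.map (· % n))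

/-- A reason why no `m ≥ M` steps of `R` lead from `a` to `b`: after `M` steps one arrives at
`t s`, where `s` is longer than `b`, and from then on only `t` is moved. -/
def Avoids {α β : Type*} (R : α × List β → α × List β → Prop) (M : ℕ) (a b : α × List β) : Prop :=
  ∃ k t s Γ, 0 < k ∧ b.2.length < s.length ∧ Steps R M a (ext t s) ∧ Steps R k t (ext t Γ)

section Rows

variable (n r) (L : List (List Letter × List Letter)) (m : ℕ) (u v : List Letter)

/-- A certificate for `u ψ ^ m = v`: it is checked on all descendants of some depth. -/
def MapsTo : Prop :=
  ∃ d, ∀ p ∈ paths n d, ∃ a b, NodeAt n u p a ∧ NodeAt n v p b ∧ Steps (Fact n L) m a b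

/-- A certificate for `u ψ ^ m ≠ v`: a path along which `u ψ ^ m` and `v` descend to different
nodes. -/
def NotMapsTo : Prop :=
  ∃ p a b c, NodeAt n u p a ∧ NodeAt n v p b ∧ Steps (Fact n L) m a c ∧ reduce n r c ≠ reduce n r b

/-- A certificate that `u ψ ^ j ≠ v` for all `j ≥ m`. -/
def EventuallyAvoids : Prop :=
  ∃ p a b, NodeAt n u p a ∧ NodeAt n v p b ∧
    (Avoids (Fact n L) m a b ∨ Avoids (flip (Fact n L)) m b a)

/-- A certificate that `u ψ ^ j ≠ v` for all natural numbers `j`. -/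
def NeverMapsTo : Prop :=
  ∃ M, EventuallyAvoids n L M u v ∧ ∀ j < M, NotMapsTo n r L j u v

/-- A certificate that some power of `ψ` takes `u p` to `u p'`, but does not take `v p` to
`v p'`. -/
def Separated : Prop :=
  ∃ k p p' a a' b b' c, NodeAt n u p a ∧ NodeAt n u p' a' ∧ NodeAt n v p b ∧ NodeAt n v p' b' ∧
    Steps (Fact n L) k a a' ∧ Steps (Fact n L) k b c ∧ reduce n r c ≠ reduce n r b'

/-- A certificate that `u` and `v` lie in different orbits. -/
def DifferentOrbits : Prop :=
  (NeverMapsTo n r L u v ∧ NeverMapsTo n r L v u) ∨ Separated n r L u v ∨ Separated n r L v u ∨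
    ∃ k, 0 < k ∧ MapsTo n L k u u ∧ ∀ j < k, NotMapsTo n r L j u v

/-- The answers for which there is a certificate. The second kind of certificate exhibits the least
period `k` of `u`, the third one shows that the orbit of `u` is infinite: no `u ψ ^ j` with large
`j` equals `u`. -/
def Certified (ans : Option (ℤ × ℕ)) : Prop :=
  (ans = none ∧ DifferentOrbits n r L u v) ∨
  (∃ m k : ℕ, ans = some ((m : ℤ), k) ∧ 0 < k ∧ MapsTo n L m u v ∧ MapsTo n L k u u ∧
    ∀ j < k, j = 0 ∨ NotMapsTo n r L j u u) ∨
  ∃ m : ℕ, ((ans = some ((m : ℤ), 0) ∧ MapsTo n L m u v) ∨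
    (ans = some (-(m : ℤ), 0) ∧ MapsTo n L m v u)) ∧ ∃ M, EventuallyAvoids n L M u u

end Rows

/-! ### Certificates are sound -/

theorem ofNode_toNode [NeZero n] [NeZero r] (a : ℕ × List ℕ) :
    ofNode (toNode n r a) = reduce n r a := by
  simp [ofNode, toNode, reduce, ofPath, toPath, Function.comp_def, Fin.ofNat]

theorem exists_steps_add {α : Type*} {R : α → α → Prop} {m k : ℕ} {a c : α}
    (h : Steps R (m + k) a c) : ∃ b, Steps R m a b := by
  induction m generalizing a with
  | zero => exact ⟨a, rfl⟩
  | succ m ih =>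
    rw [Nat.add_right_comm] at h
    obtain ⟨a', ha, h⟩ := h
    obtain ⟨b, hb⟩ := ih h
    exact ⟨b, a', ha, hb⟩

theorem exists_steps_of_steps_ext {α β : Type*} {R : α × List β → α × List β → Prop}
    (hR : ∀ a b s, R a b → R (ext a s) (ext b s)) {k : ℕ} (hk : 0 < k) {t : α × List β}
    {Γ : List β} (h : Steps R k t (ext t Γ)) (j : ℕ) : ∃ c, Steps R j t c := by
  induction j using Nat.strong_induction_on with
  | _ j ih =>
    rcases le_total j k with hj | hj
    · obtain ⟨i, rfl⟩ := Nat.exists_eq_add_of_le hj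
      exact exists_steps_add h
    · obtain ⟨i, rfl⟩ := Nat.exists_eq_add_of_le hj
      obtain ⟨c, hc⟩ := ih i (by omega)
      exact ⟨ext c Γ, h.trans (hc.map (f := fun a => ext a Γ) fun a b => hR a b Γ)⟩

theorem Avoids.pow_smul_ne (hn : 2 ≤ n) [NeZero n] [NeZero r] {ψ : G n r}
    {R : ℕ × List ℕ → ℕ × List ℕ → Prop} (hR : ∀ a b s, R a b → R (ext a s) (ext b s))
    (hψ : ∀ a b, R a b → ψ • node (toNode n r a) = node (toNode n r b)) {M : ℕ} {a b : ℕ × List ℕ}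
    (h : Avoids R M a b) {m : ℕ} (hm : M ≤ m) :
    ψ ^ m • node (toNode n r a) ≠ node (toNode n r b) := by
  obtain ⟨k, t, s, Γ, hk, hlen, h1, h2⟩ := h
  obtain ⟨j, rfl⟩ := Nat.exists_eq_add_of_le hm
  obtain ⟨c, hc⟩ := exists_steps_of_steps_ext hR hk h2 j
  have h3 := h1.trans (hc.map (f := fun a => ext a s) fun a b => hR a b s)
  intro h4
  rw [h3.smul_eq (f := fun a => node (toNode n r a)) hψ] at h4
  have h5 := congrArg (fun a : Node n r => a.2.length) (node_injective hn h4)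
  simp [toNode] at h5
  omega

theorem orbit_eq_orbit_iff {ψ : G n r} {x y : V n r} :
    orbit ψ x = orbit ψ y ↔ ∃ j : ℤ, ψ ^ j • x = y := by
  constructor
  · intro h
    have : y ∈ orbit ψ y := ⟨0, rfl⟩
    rwa [← h] at this
  · rintro ⟨j, rfl⟩
    ext z
    constructor
    · rintro ⟨i, rfl⟩
      refine ⟨i - j, ?_⟩
      change ψ ^ (i - j) • ψ ^ j • x = ψ ^ i • x
      rw [smul_smul, ← zpow_add, sub_add_cancel]
    · rintro ⟨i, rfl⟩
      refine ⟨i + j, ?_⟩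
      change ψ ^ (i + j) • x = ψ ^ i • ψ ^ j • x
      rw [zpow_add, mul_smul]

theorem isOrbitAnswer_some {ψ : G n r} {x y : V n r} {j : ℤ} (h : ψ ^ j • x = y) :
    IsOrbitAnswer ψ x y (some (j, MulAction.period ψ x)) := by
  refine ⟨orbit_eq_orbit_iff.2 ⟨j, h⟩, ?_⟩
  ext i
  change ψ ^ i • x = y ↔ _
  rw [← h, ← inv_smul_eq_iff, ← zpow_neg, smul_smul, ← zpow_add,
    MulAction.zpow_smul_eq_iff_period_dvd]
  constructor
  · rintro ⟨t, ht⟩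
    exact ⟨t, by rw [← ht]; ring⟩
  · rintro ⟨t, rfl⟩
    exact ⟨t, by ring⟩

section Sound

variable [NeZero n] [NeZero r] {L : List (Word n r × Word n r)} {ψ : G n r} {u v : Word n r}
  {m : ℕ}

theorem Describes.pow_smul_node (hL : Describes L ψ) {a b : ℕ × List ℕ}
    (h : Steps (Fact n (rows L)) m a b) :
    ψ ^ m • node (toNode n r a) = node (toNode n r b) :=
  h.smul_eq (f := fun a => node (toNode n r a)) fun _ _ => hL.smul_node

theorem MapsTo.sound (hL : Describes L ψ) (h : MapsTo n (rows L) m u.toRow v.toRow) :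
    ψ ^ m • u.toV = v.toV := by
  obtain ⟨d, hd⟩ := h
  refine eq_of_forall_descs (n := n) d fun p hp => ?_
  obtain ⟨a, b, ha, hb, hab⟩ := hd _ (mem_paths.2 ⟨p, hp, rfl⟩)
  have h1 := ha.sound
  have h2 := hb.sound
  rw [toPath_ofPath] at h1 h2
  rw [← smul_descs, h1, h2, hL.pow_smul_node hab]

theorem smul_ne_of_reduce_ne (hn : 2 ≤ n) (hL : Describes L ψ) {a b c : ℕ × List ℕ}
    (h : Steps (Fact n (rows L)) m a c) (hne : reduce n r c ≠ reduce n r b) :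
    ψ ^ m • node (toNode n r a) ≠ node (toNode n r b) := by
  rw [hL.pow_smul_node h]
  intro h
  apply hne
  rw [← ofNode_toNode, ← ofNode_toNode, node_injective hn h]

theorem NotMapsTo.sound (hn : 2 ≤ n) (hL : Describes L ψ)
    (h : NotMapsTo n r (rows L) m u.toRow v.toRow) : ψ ^ m • u.toV ≠ v.toV := by
  obtain ⟨p, a, b, c, ha, hb, hc, hne⟩ := h
  rintro h
  apply smul_ne_of_reduce_ne hn hL hc hne
  rw [← ha.sound, ← hb.sound, smul_descs, h]

theorem EventuallyAvoids.sound (hn : 2 ≤ n) (hL : Describes L ψ)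
    (h : EventuallyAvoids n (rows L) m u.toRow v.toRow) {j : ℕ} (hj : m ≤ j) :
    ψ ^ j • u.toV ≠ v.toV := by
  obtain ⟨p, a, b, ha, hb, h⟩ := h
  intro huv
  have key : ψ ^ j • node (toNode n r a) = node (toNode n r b) := by
    rw [← ha.sound, ← hb.sound, smul_descs, huv]
  rcases h with h | h
  · exact h.pow_smul_ne hn (fun _ _ s h => h.ext s) (fun _ _ => hL.smul_node) hj key
  · refine h.pow_smul_ne (ψ := ψ⁻¹) hn (fun a b s (h : Fact n (rows L) b a) => h.ext s)
      (fun c d hcd => ?_) hj ?_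
    · rw [inv_smul_eq_iff, hL.smul_node hcd]
    · rw [inv_pow, inv_smul_eq_iff, key]

theorem NeverMapsTo.sound (hn : 2 ≤ n) (hL : Describes L ψ)
    (h : NeverMapsTo n r (rows L) u.toRow v.toRow) (j : ℕ) : ψ ^ j • u.toV ≠ v.toV := by
  obtain ⟨M, h1, h2⟩ := h
  rcases lt_or_ge j M with hj | hj
  · exact (h2 j hj).sound hn hL
  · exact h1.sound hn hL hj

theorem Separated.sound (hn : 2 ≤ n) (hL : Describes L ψ)
    (h : Separated n r (rows L) u.toRow v.toRow) (j : ℤ) : ψ ^ j • u.toV ≠ v.toV := by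
  obtain ⟨k, p, p', a, a', b, b', c, ha, ha', hb, hb', h1, h2, hne⟩ := h
  intro h
  apply smul_ne_of_reduce_ne hn hL h2 hne
  -- powers of `ψ` commute
  rw [← hb.sound, ← hb'.sound, ← h, ← smul_descs, ← smul_descs, smul_smul, ← zpow_natCast,
    ← zpow_add, add_comm, zpow_add, mul_smul, ha.sound, ha'.sound, zpow_natCast,
    hL.pow_smul_node h1]

theorem DifferentOrbits.sound (hn : 2 ≤ n) (hL : Describes L ψ)
    (h : DifferentOrbits n r (rows L) u.toRow v.toRow) (j : ℤ) : ψ ^ j • u.toV ≠ v.toV := by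
  rcases h with ⟨h1, h2⟩ | h | h | ⟨k, hk, h1, h2⟩
  · rcases Int.eq_nat_or_neg j with ⟨j, rfl | rfl⟩
    · rw [zpow_natCast]
      exact h1.sound hn hL j
    · intro h
      rw [zpow_neg, zpow_natCast, inv_smul_eq_iff] at h
      exact h2.sound hn hL j h.symm
  · exact h.sound hn hL j
  · intro h'
    refine h.sound hn hL (-j) ?_
    rw [zpow_neg, inv_smul_eq_iff, h']
  · -- the exponent can be reduced modulo the period `k` of `u`
    have hk' : (k : ℤ) ≠ 0 := by omega
    obtain ⟨i, hi⟩ := Int.eq_ofNat_of_zero_le (Int.emod_nonneg j hk')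
    have hik : i < k := by
      have := Int.emod_lt_of_pos j (by omega : (0 : ℤ) < k)
      omega
    have hdvd : (MulAction.period ψ u.toV : ℤ) ∣ k :=
      Int.natCast_dvd_natCast.2 (MulAction.pow_smul_eq_iff_period_dvd.1 (h1.sound hL))
    have h3 := (h2 i hik).sound hn hL
    rw [← Int.emod_add_mul_ediv j k, hi, zpow_add, mul_smul,
      MulAction.zpow_smul_eq_iff_period_dvd.2 (hdvd.mul_right _)]
    simpa using h3

theorem Certified.sound (hn : 2 ≤ n) (hL : Describes L ψ) {ans : Option (ℤ × ℕ)}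
    (h : Certified n r (rows L) u.toRow v.toRow ans) : IsOrbitAnswer ψ u.toV v.toV ans := by
  rcases h with ⟨rfl, h⟩ | ⟨m, k, rfl, hk, h1, h2, h3⟩ | ⟨m, h, M, hM⟩
  · intro h'
    obtain ⟨j, hj⟩ := orbit_eq_orbit_iff.1 h'
    exact h.sound hn hL j hj
  · have h4 := MulAction.pow_smul_eq_iff_period_dvd.1 (h2.sound hL)
    have h5 : MulAction.period ψ u.toV = k := by
      by_contra hne
      have hlt := lt_of_le_of_ne (Nat.le_of_dvd hk h4) hne
      rcases h3 _ hlt with h0 | h0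
      · rw [h0, zero_dvd_iff] at h4
        omega
      · exact h0.sound hn hL (MulAction.pow_period_smul ψ u.toV)
    rw [← h5]
    exact isOrbitAnswer_some (by rw [zpow_natCast]; exact h1.sound hL)
  · -- a positive period would have a multiple beyond the bound `M`
    have h0 : MulAction.period ψ u.toV = 0 := by
      by_contra h0
      exact hM.sound hn hL (Nat.le_mul_of_pos_left M (Nat.pos_of_ne_zero h0))
        (MulAction.pow_smul_eq_iff_period_dvd.2 (dvd_mul_right _ _))
    rw [← h0] at h
    rcases h with ⟨rfl, h⟩ | ⟨rfl, h⟩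
    · exact isOrbitAnswer_some (by rw [zpow_natCast]; exact h.sound hL)
    · exact isOrbitAnswer_some (by rw [zpow_neg, zpow_natCast, inv_smul_eq_iff, h.sound hL])

end Sound

end Higman

/-! ### Certificates exist -/

namespace Higman

variable {n r : ℕ}

theorem Grows.ext {F : Node n r → Node n r → Prop}
    (hF : ∀ a b s, F a b → F (ext a s) (ext b s)) {a : Node n r} (h : Grows F a)
    (q : List (Fin n)) : Grows F (ext a q) := by
  obtain ⟨M, k, t, s, Γ, hΓ, h1, h2⟩ := h
  refine ⟨M, k, t, s ++ q, Γ, hΓ, ?_, h2⟩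
  rw [ext_append]
  exact h1.map (f := fun a => Higman.ext a q) fun a b => hF a b q

theorem Grows.exists_avoids {F : Node n r → Node n r → Prop}
    (hF : ∀ a b s, F a b → F (Higman.ext a s) (Higman.ext b s)) {a : Node n r} (h : Grows F a)
    (b : Node n r) : ∃ M, Avoids F M a b := by
  obtain ⟨M, k, t, s, Γ, hΓ, h1, h2⟩ := h
  have hk : 0 < k := by
    rcases Nat.eq_zero_or_pos k with rfl | hk
    · have h3 := congrArg (fun a : Node n r => a.2.length) (show t = Higman.ext t Γ from h2)
      rw [ext_length] at h3
      exact absurd (List.length_eq_zero_iff.1 (by omega)) hΓ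
    · exact hk
  -- go round the cycle often enough for the resting part to become longer than `b`
  have key (i : ℕ) : ∃ M s', i ≤ s'.length ∧ Steps F M a (Higman.ext t s') := by
    induction i with
    | zero => exact ⟨M, s, by simp, h1⟩
    | succ i ih =>
      obtain ⟨M', s', hs', h3⟩ := ih
      refine ⟨M' + k, Γ ++ s', ?_, ?_⟩
      · have := List.length_pos_of_ne_nil hΓ
        simp
        omega
      · rw [ext_append]
        exact h3.trans (h2.map (f := fun a => Higman.ext a s') fun a b => hF a b s')
  obtain ⟨M', s', hs', h3⟩ := key (b.2.length + 1)
  exact ⟨M', k, t, s', Γ, hk, hs', h3, h2⟩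

theorem Avoids.ofNode {F : Node n r → Node n r → Prop} {R : ℕ × List ℕ → ℕ × List ℕ → Prop}
    (hFR : ∀ a b, F a b → R (ofNode a) (ofNode b)) {M : ℕ} {a b : Node n r} (h : Avoids F M a b) :
    Avoids R M (ofNode a) (ofNode b) := by
  obtain ⟨k, t, s, Γ, hk, hlen, h1, h2⟩ := h
  have h3 := h1.map (S := R) hFR
  have h4 := h2.map (S := R) hFR
  rw [ofNode_ext] at h3 h4
  exact ⟨k, Higman.ofNode t, ofPath s, ofPath Γ, hk, by simpa [Higman.ofNode] using hlen, h3, h4⟩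

theorem exists_descs_ne {x y : V n r} (h : x ≠ y) (d : ℕ) :
    ∃ p : List (Fin n), p.length = d ∧ descs p x ≠ descs p y := by
  by_contra! h'
  exact h (eq_of_forall_descs d h')

theorem NodeAt.sound_ofNode [NeZero n] [NeZero r] {w : Word n r} {p : List (Fin n)} {a : Node n r}
    (h : NodeAt n w.toRow (ofPath p) (ofNode a)) : descs p w.toV = node a := by
  simpa using h.sound

theorem steps_fact_of_nodeFact {L : List (Word n r × Word n r)} {m : ℕ}
    {a b : Node n r} (h : Steps (nodeFact L) m a b) :
    Steps (Fact n (rows L)) m (ofNode a) (ofNode b) :=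
  h.map (f := ofNode) fun _ _ h => h

section Complete

variable [NeZero n] [NeZero r] {L : List (Word n r × Word n r)} {ψ : G n r} {u v : Word n r}
  {m : ℕ}

theorem MapsTo.complete (hn : 2 ≤ n) (hL : Describes L ψ) (h : ψ ^ m • u.toV = v.toV) :
    MapsTo n (rows L) m u.toRow v.toRow := by
  have hT := hL.tracks hn
  obtain ⟨D, hD⟩ := hT.steps_total m
  obtain ⟨Du, hu⟩ := NodeAt.complete u D
  obtain ⟨Dv, hv⟩ := NodeAt.complete v 0
  refine ⟨max Du Dv, fun p hp => ?_⟩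
  obtain ⟨p, hp, rfl⟩ := mem_paths.1 hp
  obtain ⟨a, ha, haD⟩ := hu p (by omega)
  obtain ⟨b, hb, -⟩ := hv p (by omega)
  obtain ⟨c, hc⟩ := hD a haD
  obtain rfl : c = b := node_injective hn (by
    rw [← hT.smul_steps hc, ← ha.sound_ofNode, ← hb.sound_ofNode, smul_descs, h])
  exact ⟨_, _, ha, hb, steps_fact_of_nodeFact hc⟩

theorem reduce_ofNode (a : Node n r) : reduce n r (ofNode a) = ofNode a := by
  rw [← ofNode_toNode, toNode_ofNode]

theorem Separated.complete (hn : 2 ≤ n) (hL : Describes L ψ) {p p' : List (Fin n)}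
    (h : ψ ^ m • descs p u.toV = descs p' u.toV) (h' : ψ ^ m • descs p v.toV ≠ descs p' v.toV) :
    Separated n r (rows L) u.toRow v.toRow := by
  have hT := hL.tracks hn
  obtain ⟨D, hD⟩ := hT.steps_total m
  obtain ⟨Du, hu⟩ := NodeAt.complete u D
  obtain ⟨Dv, hv⟩ := NodeAt.complete v D
  obtain ⟨q, hq, hne⟩ := exists_descs_ne h' (max Du Dv)
  rw [← smul_descs, ← descs_append, ← descs_append] at hne
  have h2 := congrArg (descs q) h
  rw [← smul_descs, ← descs_append, ← descs_append] at h2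
  obtain ⟨a, ha, haD⟩ := hu (p ++ q) (by simp; omega)
  obtain ⟨a', ha', -⟩ := hu (p' ++ q) (by simp; omega)
  obtain ⟨b, hb, hbD⟩ := hv (p ++ q) (by simp; omega)
  obtain ⟨b', hb', -⟩ := hv (p' ++ q) (by simp; omega)
  obtain ⟨c', hc'⟩ := hD a haD
  obtain ⟨c, hc⟩ := hD b hbD
  obtain rfl : c' = a' := node_injective hn (by
    rw [← hT.smul_steps hc', ← ha.sound_ofNode, ← ha'.sound_ofNode, h2])
  refine ⟨m, _, _, _, _, _, _, _, ha, ha', hb, hb', steps_fact_of_nodeFact hc',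
    steps_fact_of_nodeFact hc, ?_⟩
  rw [reduce_ofNode, reduce_ofNode]
  intro heq
  apply hne
  rw [hb.sound_ofNode, hb'.sound_ofNode, hT.smul_steps hc, ofNode_injective heq]

theorem NotMapsTo.complete (hn : 2 ≤ n) (hL : Describes L ψ) (h : ψ ^ m • u.toV ≠ v.toV) :
    NotMapsTo n r (rows L) m u.toRow v.toRow := by
  have hT := hL.tracks hn
  obtain ⟨D, hD⟩ := hT.steps_total m
  obtain ⟨Du, hu⟩ := NodeAt.complete u D
  obtain ⟨Dv, hv⟩ := NodeAt.complete v 0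
  obtain ⟨q, hq, hne⟩ := exists_descs_ne h (max Du Dv)
  obtain ⟨a, ha, haD⟩ := hu q (by omega)
  obtain ⟨b, hb, -⟩ := hv q (by omega)
  obtain ⟨c, hc⟩ := hD a haD
  refine ⟨_, _, _, _, ha, hb, steps_fact_of_nodeFact hc, ?_⟩
  rw [reduce_ofNode, reduce_ofNode]
  intro heq
  apply hne
  rw [← smul_descs, ha.sound_ofNode, hb.sound_ofNode, hT.smul_steps hc, ofNode_injective heq]

/-- If `u` has growth, then far along one path both `u` and `v` are nodes, that of `u` still
grows, and it becomes deeper than that of `v`. -/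
theorem HasGrowth.exists_avoids (hn : 2 ≤ n) {F : Node n r → Node n r → Prop}
    (hF : ∀ a b s, F a b → F (ext a s) (ext b s)) (h : HasGrowth F u.toV) (v : Word n r) :
    ∃ (M : ℕ) (p : List (Fin n)) (a b : Node n r), NodeAt n u.toRow (ofPath p) (ofNode a) ∧
      NodeAt n v.toRow (ofPath p) (ofNode b) ∧ Avoids F M a b := by
  obtain ⟨p, a₀, hp, ha₀⟩ := h
  obtain ⟨Du, hu⟩ := NodeAt.complete u 0
  obtain ⟨Dv, hv⟩ := NodeAt.complete v 0
  let q : List (Fin n) := List.replicate (max Du Dv) 0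
  obtain ⟨a, ha, -⟩ := hu (p ++ q) (by simp [q]; omega)
  obtain ⟨b, hb, -⟩ := hv (p ++ q) (by simp [q]; omega)
  obtain rfl : a = Higman.ext a₀ q := node_injective hn (by
    rw [node_ext, ← hp, ← ha.sound_ofNode, descs_append])
  obtain ⟨M, hM⟩ := (ha₀.ext hF q).exists_avoids hF b
  exact ⟨M, _, _, _, ha, hb, hM⟩

theorem HasGrowth.exists_eventuallyAvoids (hn : 2 ≤ n) (h : HasGrowth (nodeFact L) u.toV)
    (v : Word n r) : ∃ M, EventuallyAvoids n (rows L) M u.toRow v.toRow := by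
  obtain ⟨M, p, a, b, ha, hb, hM⟩ :=
    h.exists_avoids hn (fun a b s (h : nodeFact L a b) => h.ext s) v
  exact ⟨M, _, _, _, ha, hb, Or.inl (hM.ofNode fun _ _ h => h)⟩

theorem HasGrowth.exists_eventuallyAvoids_of_flip (hn : 2 ≤ n)
    (h : HasGrowth (flip (nodeFact L)) v.toV) (u : Word n r) :
    ∃ M, EventuallyAvoids n (rows L) M u.toRow v.toRow := by
  obtain ⟨M, p, a, b, ha, hb, hM⟩ :=
    h.exists_avoids hn (fun a b s (h : nodeFact L b a) => h.ext s) u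
  exact ⟨M, _, _, _, hb, ha, Or.inr (hM.ofNode fun _ _ h => h)⟩

theorem NeverMapsTo.complete (hn : 2 ≤ n) (hL : Describes L ψ)
    (h : ∀ j : ℕ, ψ ^ j • u.toV ≠ v.toV) (hM : ∃ M, EventuallyAvoids n (rows L) M u.toRow v.toRow) :
    NeverMapsTo n r (rows L) u.toRow v.toRow := by
  obtain ⟨M, hM⟩ := hM
  exact ⟨M, hM, fun j _ => NotMapsTo.complete hn hL (h j)⟩

/-- A hyperbolic descendant of `u` either separates `u` from `v`, or the same descendant of `v` is
hyperbolic in the same way, and then both grow in the same direction of time. -/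
theorem separated_or_hasGrowth (hn : 2 ≤ n) (hL : Describes L ψ) {p Γ : List (Fin n)} (hΓ : Γ ≠ [])
    (h : ψ ^ m • descs p u.toV = descs Γ (descs p u.toV) ∨
      ψ ^ m • descs Γ (descs p u.toV) = descs p u.toV) :
    Separated n r (rows L) u.toRow v.toRow ∨
      (HasGrowth (nodeFact L) u.toV ∧ HasGrowth (nodeFact L) v.toV) ∨
      (HasGrowth (flip (nodeFact L)) u.toV ∧ HasGrowth (flip (nodeFact L)) v.toV) := by
  by_contra! hcon
  obtain ⟨hsep, h1, h2⟩ := hcon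
  rcases h with h | h
  · by_cases hv : ψ ^ m • descs p v.toV = descs Γ (descs p v.toV)
    · exact h1 ((hL.tracks hn).hasGrowth_of_smul_eq_descs hn hΓ h).of_descs
        ((hL.tracks hn).hasGrowth_of_smul_eq_descs hn hΓ hv).of_descs
    · exact hsep (Separated.complete (p := p) (p' := p ++ Γ) hn hL (by rw [h, descs_append])
        (by rwa [descs_append]))
  · by_cases hv : ψ ^ m • descs Γ (descs p v.toV) = descs p v.toV
    · exact h2 ((hL.tracks_inv hn).hasGrowth_of_smul_descs_eq hn hΓ h).of_descs
        ((hL.tracks_inv hn).hasGrowth_of_smul_descs_eq hn hΓ hv).of_descs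
    · exact hsep (Separated.complete (p := p ++ Γ) (p' := p) hn hL (by rw [descs_append, h])
        (by rwa [descs_append]))

theorem DifferentOrbits.complete (hn : 2 ≤ n) (hL : Describes L ψ)
    (h : ∀ j : ℤ, ψ ^ j • u.toV ≠ v.toV) : DifferentOrbits n r (rows L) u.toRow v.toRow := by
  have hpos (j : ℕ) : ψ ^ j • u.toV ≠ v.toV := by
    rw [← zpow_natCast]
    exact h j
  have hneg (j : ℕ) : ψ ^ j • v.toV ≠ u.toV := by
    intro h'
    apply h (-j)
    rw [zpow_neg, inv_smul_eq_iff, zpow_natCast, h']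
  by_cases hu : IsPeriodic ψ u.toV
  · obtain ⟨k, hk, hu⟩ := hu
    exact Or.inr (Or.inr (Or.inr ⟨k, hk, MapsTo.complete hn hL hu, fun j _ =>
      NotMapsTo.complete hn hL (hpos j)⟩))
  suffices hs : Separated n r (rows L) u.toRow v.toRow ∨ Separated n r (rows L) v.toRow u.toRow ∨
      (HasGrowth (nodeFact L) u.toV ∧ HasGrowth (nodeFact L) v.toV) ∨
      (HasGrowth (flip (nodeFact L)) u.toV ∧ HasGrowth (flip (nodeFact L)) v.toV) by
    rcases hs with hs | hs | ⟨h1, h2⟩ | ⟨h1, h2⟩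
    · exact Or.inr (Or.inl hs)
    · exact Or.inr (Or.inr (Or.inl hs))
    · exact Or.inl ⟨.complete hn hL hpos (h1.exists_eventuallyAvoids hn v),
        .complete hn hL hneg (h2.exists_eventuallyAvoids hn u)⟩
    · exact Or.inl ⟨.complete hn hL hpos (h2.exists_eventuallyAvoids_of_flip hn u),
        .complete hn hL hneg (h1.exists_eventuallyAvoids_of_flip hn v)⟩
  obtain ⟨p, ⟨a, hp, ha⟩ | ⟨k, Γ, hΓ, hk⟩⟩ :=
    (hL.tracks hn).exists_grows_or_hyperbolic hn hu
  · by_cases hv : IsPeriodic ψ v.toV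
    · obtain ⟨k, hk, hv⟩ := hv
      exact Or.inr (Or.inl (Separated.complete (p := []) (p' := []) hn hL hv
        fun hu' => hu ⟨k, hk, hu'⟩))
    obtain ⟨q, ⟨b, hq, hb⟩ | ⟨k, Γ, hΓ, hk⟩⟩ :=
      (hL.tracks hn).exists_grows_or_hyperbolic hn hv
    · exact Or.inr (Or.inr (Or.inl ⟨⟨p, a, hp, ha⟩, q, b, hq, hb⟩))
    · have := separated_or_hasGrowth (v := u) hn hL hΓ hk
      tauto
  · have := separated_or_hasGrowth (v := v) hn hL hΓ hk
    tauto

theorem Certified.complete (hn : 2 ≤ n) (hL : Describes L ψ) (u v : Word n r) :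
    ∃ ans, Certified n r (rows L) u.toRow v.toRow ans := by
  by_cases h : ∃ j : ℤ, ψ ^ j • u.toV = v.toV
  swap
  · exact ⟨none, Or.inl ⟨rfl, DifferentOrbits.complete hn hL (not_exists.1 h)⟩⟩
  obtain ⟨j, hj⟩ := h
  by_cases hu : IsPeriodic ψ u.toV
  · obtain ⟨k, hk, hu⟩ := hu
    have hpos := MulAction.period_pos_of_fixed hk hu
    have h0 : 0 ≤ j % (MulAction.period ψ u.toV : ℤ) := Int.emod_nonneg _ (by omega)
    obtain ⟨m, hm⟩ := Int.eq_ofNat_of_zero_le h0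
    refine ⟨some (m, _), Or.inr (Or.inl ⟨m, _, rfl, hpos, MapsTo.complete hn hL ?_,
      MapsTo.complete hn hL (MulAction.pow_period_smul ψ u.toV), fun i hi => ?_⟩)⟩
    · rw [← zpow_natCast, ← hm, MulAction.zpow_mod_period_smul, hj]
    · rcases Nat.eq_zero_or_pos i with h0 | h0
      · exact Or.inl h0
      · exact Or.inr (NotMapsTo.complete hn hL (MulAction.pow_smul_ne_of_lt_period h0 hi))
  · have hM : ∃ M, EventuallyAvoids n (rows L) M u.toRow u.toRow := by
      obtain ⟨p, ⟨a, hp, ha⟩ | ⟨k, Γ, hΓ, hk | hk⟩⟩ :=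
        (hL.tracks hn).exists_grows_or_hyperbolic hn hu
      · exact HasGrowth.exists_eventuallyAvoids hn ⟨p, a, hp, ha⟩ u
      · exact ((hL.tracks hn).hasGrowth_of_smul_eq_descs
          hn hΓ hk).of_descs.exists_eventuallyAvoids hn u
      · exact ((hL.tracks_inv hn).hasGrowth_of_smul_descs_eq
          hn hΓ hk).of_descs.exists_eventuallyAvoids_of_flip hn u
    rcases Int.eq_nat_or_neg j with ⟨m, rfl | rfl⟩
    · exact ⟨_, Or.inr (Or.inr ⟨m, Or.inl ⟨rfl, MapsTo.complete hn hL
        (by rwa [zpow_natCast] at hj)⟩, hM⟩)⟩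
    · exact ⟨_, Or.inr (Or.inr ⟨m, Or.inr ⟨rfl, MapsTo.complete hn hL
        (by rw [← hj, zpow_neg, zpow_natCast, smul_inv_smul])⟩, hM⟩)⟩

end Complete

end Higman

/-! ### Searchable predicates -/

/-- A predicate of the form `∃ k, f a k` with `f` primitive recursive. -/
def Searchable {α : Type*} [Primcodable α] (p : α → Prop) : Prop :=
  ∃ f : α → ℕ → Bool, Primrec₂ f ∧ ∀ a, p a ↔ ∃ k, f a k = true

namespace Searchable

variable {α β γ δ : Type*} [Primcodable α] [Primcodable β] [Primcodable γ] [Primcodable δ]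

theorem of_primrecPred {p : α → Prop} (hp : PrimrecPred p) : Searchable p := by
  classical
  exact ⟨fun a _ => decide (p a), hp.decide.comp Primrec.fst, fun a => by simp⟩

theorem comp {p : β → Prop} (hp : Searchable p) {g : α → β} (hg : Primrec g) :
    Searchable fun a => p (g a) := by
  obtain ⟨f, hf, h⟩ := hp
  exact ⟨fun a k => f (g a) k, hf.comp (hg.comp .fst) .snd, fun a => h _⟩

theorem of_iff {p q : α → Prop} (hp : Searchable p) (h : ∀ a, q a ↔ p a) : Searchable q := by
  rwa [funext fun a => propext (h a)]

theorem and {p q : α → Prop} (hp : Searchable p) (hq : Searchable q) :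
    Searchable fun a => p a ∧ q a := by
  obtain ⟨f, hf, h⟩ := hp
  obtain ⟨g, hg, h'⟩ := hq
  have h1 : Primrec fun x : α × ℕ => x.2.unpair := Primrec.unpair.comp .snd
  refine ⟨fun a k => f a k.unpair.1 && g a k.unpair.2,
    Primrec.and.comp (hf.comp .fst (Primrec.fst.comp h1)) (hg.comp .fst (Primrec.snd.comp h1)),
    fun a => ?_⟩
  simp only [h, h', Bool.and_eq_true]
  constructor
  · rintro ⟨⟨i, hi⟩, j, hj⟩
    exact ⟨Nat.pair i j, by simpa using ⟨hi, hj⟩⟩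
  · rintro ⟨k, hi, hj⟩
    exact ⟨⟨_, hi⟩, _, hj⟩

theorem or {p q : α → Prop} (hp : Searchable p) (hq : Searchable q) :
    Searchable fun a => p a ∨ q a := by
  obtain ⟨f, hf, h⟩ := hp
  obtain ⟨g, hg, h'⟩ := hq
  refine ⟨fun a k => f a k || g a k, Primrec.or.comp hf hg, fun a => ?_⟩
  simp only [h, h', Bool.or_eq_true, exists_or]

theorem ex {p : α → β → Prop} (hp : Searchable fun x : α × β => p x.1 x.2) :
    Searchable fun a => ∃ b, p a b := by
  obtain ⟨f, hf, h⟩ := hp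
  have h1 : Primrec fun x : α × ℕ => x.2.unpair := Primrec.unpair.comp .snd
  refine ⟨fun a k => Option.casesOn (Encodable.decode (α := β) k.unpair.1) false
    fun b => f (a, b) k.unpair.2, ?_, fun a => ?_⟩
  · refine Primrec.option_casesOn (Primrec.decode.comp (Primrec.fst.comp h1)) (Primrec.const _) ?_
    exact hf.comp (Primrec.pair (Primrec.fst.comp .fst) .snd) (Primrec.snd.comp (h1.comp .fst))
  · constructor
    · rintro ⟨b, hb⟩
      obtain ⟨k, hk⟩ := (h (a, b)).1 hb
      exact ⟨Nat.pair (Encodable.encode b) k, by simpa using hk⟩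
    · rintro ⟨k, hk⟩
      cases hb : Encodable.decode (α := β) k.unpair.1 with
      | none => simp [hb] at hk
      | some b => exact ⟨b, (h (a, b)).2 ⟨_, by simpa [hb] using hk⟩⟩

theorem forall_mem {p : α → β → Prop} (hp : Searchable fun x : α × β => p x.1 x.2)
    {l : α → List β} (hl : Primrec l) : Searchable fun a => ∀ b ∈ l a, p a b := by
  classical
  obtain ⟨f, hf, h⟩ := hp
  -- one bound for the searches for all members of the list
  have h1 : PrimrecRel fun (k : ℕ) (x : α × β) => f x k = true :=
    Primrec.eq.comp (hf.comp .snd .fst) (Primrec.const true)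
  have h2 : PrimrecPred fun y : β × α × ℕ => ∃ k ∈ List.range y.2.2, f (y.2.1, y.1) k = true :=
    h1.exists_mem_list.comp (Primrec.list_range.comp (Primrec.snd.comp .snd))
      (Primrec.pair (Primrec.fst.comp .snd) .fst)
  have h3 : PrimrecPred fun x : α × ℕ => ∀ b ∈ l x.1, ∃ k ∈ List.range x.2, f (x.1, b) k = true :=
    (PrimrecRel.forall_mem_list 
      (R := fun b (x : α × ℕ) => ∃ k ∈ List.range x.2, f (x.1, b) k = true) h2).comp
      (hl.comp .fst) Primrec.id
  refine ⟨fun a K => decide (∀ b ∈ l a, ∃ k ∈ List.range K, f (a, b) k = true), h3.decide,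
    fun a => ?_⟩
  simp only [decide_eq_true_eq, List.mem_range]
  constructor
  · intro ha
    have (b : β) : ∃ k, b ∈ l a → f (a, b) k = true := by
      by_cases hb : b ∈ l a
      · obtain ⟨k, hk⟩ := (h (a, b)).1 (ha b hb)
        exact ⟨k, fun _ => hk⟩
      · exact ⟨0, fun h => absurd h hb⟩
    choose k hk using this
    refine ⟨((l a).map fun b => k b + 1).sum, fun b hb => ⟨k b, ?_, hk b hb⟩⟩
    exact Nat.lt_of_succ_le (List.le_sum_of_mem (List.mem_map.2 ⟨b, hb, rfl⟩))
  · rintro ⟨K, hK⟩ b hb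
    obtain ⟨k, -, hk⟩ := hK b hb
    exact (h (a, b)).2 ⟨k, hk⟩

theorem forall_lt {p : α → ℕ → Prop} (hp : Searchable fun x : α × ℕ => p x.1 x.2)
    {m : α → ℕ} (hm : Primrec m) : Searchable fun a => ∀ i < m a, p a i :=
  (hp.forall_mem (Primrec.list_range.comp hm)).of_iff fun a => by simp

theorem eq {f g : α → β} (hf : Primrec f) (hg : Primrec g) : Searchable fun a => f a = g a :=
  of_primrecPred (Primrec.eq.comp hf hg)

theorem ne {f g : α → β} (hf : Primrec f) (hg : Primrec g) : Searchable fun a => f a ≠ g a :=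
  of_primrecPred (Primrec.eq.comp hf hg).not

theorem lt {f g : α → ℕ} (hf : Primrec f) (hg : Primrec g) : Searchable fun a => f a < g a :=
  of_primrecPred (Primrec.nat_lt.comp hf hg)

theorem mem {f : α → β} {l : α → List β} (hf : Primrec f) (hl : Primrec l) :
    Searchable fun a => f a ∈ l a :=
  of_primrecPred
    ((PrimrecRel.exists_mem_list (R := fun a b : β => a = b) Primrec.eq |>.comp hl hf).of_eq
      fun a => by simp)

/-- If every input in a class has an answer that can be found by a search, then the search is a
partial recursive function that is defined on this class. -/
theorem exists_partrec {p : α → β → Prop} (hp : Searchable fun x : α × β => p x.1 x.2) :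
    ∃ F : α →. β, Partrec F ∧ ∀ a, (∃ b, p a b) → ∃ b ∈ F a, p a b := by
  obtain ⟨f, hf, h⟩ := hp
  have h1 : Primrec fun x : α × ℕ => x.2.unpair := Primrec.unpair.comp .snd
  let g (a : α) (k : ℕ) : Option β := (Encodable.decode (α := β) k.unpair.1).bind fun b =>
    bif f (a, b) k.unpair.2 then some b else none
  have hg : Primrec₂ g := by
    refine Primrec.option_bind (Primrec.decode.comp (Primrec.fst.comp h1)) ?_
    refine Primrec.cond ?_ (Primrec.option_some.comp .snd) (Primrec.const none)
    exact hf.comp (Primrec.pair (Primrec.fst.comp .fst) .snd) (Primrec.snd.comp (h1.comp .fst))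
  have hgp (a : α) (k : ℕ) (b : β) (hb : b ∈ g a k) : p a b := by
    simp only [g, Option.mem_def, Option.bind_eq_some_iff] at hb
    obtain ⟨b', -, hb⟩ := hb
    cases hfb : f (a, b') k.unpair.2 with
    | false => simp [hfb] at hb
    | true =>
      obtain rfl : b' = b := by simpa [hfb] using hb
      exact (h (a, b')).2 ⟨_, hfb⟩
  refine ⟨fun a => Nat.rfindOpt (g a), Partrec.rfindOpt hg.to_comp, fun a ⟨b, hb⟩ => ?_⟩
  obtain ⟨k, hk⟩ := (h (a, b)).1 hb
  have hdom : (Nat.rfindOpt (g a)).Dom :=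
    Nat.rfindOpt_dom.2 ⟨Nat.pair (Encodable.encode b) k, b, by simp [g, hk]⟩
  refine ⟨_, Part.get_mem hdom, ?_⟩
  obtain ⟨k, hk⟩ := Nat.rfindOpt_spec (Part.get_mem hdom)
  exact hgp _ _ _ hk

end Searchable

/-! ### Certificates can be searched for -/

namespace Higman

variable {α β γ : Type*} [Primcodable α] [Primcodable β] [Primcodable γ]

theorem primrec_ext : Primrec₂ (ext : α × List β → List β → α × List β) :=
  (Primrec.pair (Primrec.fst.comp .fst) (Primrec.list_append.comp (Primrec.snd.comp .fst) .snd) :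
    Primrec fun x : (α × List β) × List β => (x.1.1, x.1.2 ++ x.2))

theorem primrec_descLeaves : Primrec₂ descLeaves := by
  have hnil : Primrec fun x : (ℕ × List Leaf) × Leaf => [(([] : List ℕ), ext x.2.2 [x.1.1])] :=
    Primrec.list_cons.comp (Primrec.pair (Primrec.const []) (primrec_ext.comp
      (Primrec.snd.comp .snd) (Primrec.list_cons.comp (Primrec.fst.comp .fst) (Primrec.const []))))
      (Primrec.const [])
  have hcons : Primrec fun x : ((ℕ × List Leaf) × Leaf) × ℕ × List ℕ =>
      if x.2.1 = x.1.1.1 then [(x.2.2, x.1.2.2)] else [] :=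
    Primrec.ite (Primrec.eq.comp (Primrec.fst.comp .snd) (Primrec.fst.comp (Primrec.fst.comp .fst)))
      (Primrec.list_cons.comp (Primrec.pair (Primrec.snd.comp .snd)
        (Primrec.snd.comp (Primrec.snd.comp .fst))) (Primrec.const [])) (Primrec.const [])
  exact Primrec.list_flatMap .snd (Primrec.list_casesOn (Primrec.fst.comp .snd) hnil hcons.to₂).to₂

theorem primrec_consLeaves : Primrec₂ consLeaves := by
  refine Primrec.list_map .snd ?_
  exact Primrec.pair (Primrec.list_cons.comp (Primrec.fst.comp .fst) (Primrec.fst.comp .snd))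
    (Primrec.snd.comp .snd)

theorem primrec_leafStep :
    Primrec fun x : (ℕ × List (List Leaf)) × Letter => leafStep x.1.1 x.1.2 x.2 := by
  have hgen : Primrec fun x : ((ℕ × List (List Leaf)) × Letter) × ℕ =>
      (([([], (x.2, []))] : List Leaf) :: x.1.1.2) :=
    Primrec.list_cons.comp (Primrec.list_cons.comp (Primrec.pair (Primrec.const [])
      (Primrec.pair .snd (Primrec.const []))) (Primrec.const []))
      (Primrec.snd.comp (Primrec.fst.comp .fst))
  have hdesc : Primrec fun x : ((ℕ × List (List Leaf)) × Letter) × ℕ =>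
      (descLeaves x.2 x.1.1.2.headI :: x.1.1.2.tail) :=
    Primrec.list_cons.comp (primrec_descLeaves.comp .snd
      (Primrec.list_headI.comp (Primrec.snd.comp (Primrec.fst.comp .fst))))
      (Primrec.list_tail.comp (Primrec.snd.comp (Primrec.fst.comp .fst)))
  have hlam : Primrec fun x : (ℕ × List (List Leaf)) × Letter =>
      ((List.range x.1.1).flatMap fun j => consLeaves j (x.1.2.getD (x.1.1 - 1 - j) [])) ::
        x.1.2.drop x.1.1 := by
    refine Primrec.list_cons.comp (Primrec.list_flatMap
      (Primrec.list_range.comp (Primrec.fst.comp .fst)) ?_)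
      (Primrec.list_drop.comp (Primrec.fst.comp .fst) (Primrec.snd.comp .fst))
    refine primrec_consLeaves.comp .snd ((Primrec.list_getD []).comp
      (Primrec.snd.comp (Primrec.fst.comp .fst)) (Primrec.nat_sub.comp (Primrec.nat_sub.comp
        (Primrec.fst.comp (Primrec.fst.comp .fst)) (Primrec.const 1)) .snd))
  have hsum : Primrec fun x : (ℕ × List (List Leaf)) × Letter => letterEquiv x.2 :=
    Primrec.of_equiv.comp .snd
  refine (Primrec.sumCasesOn hsum hgen.to₂ (Primrec.sumCasesOn
    (f := fun x : ((ℕ × List (List Leaf)) × Letter) × (ℕ ⊕ Unit) => x.2) .snd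
    (hdesc.comp (Primrec.pair (Primrec.fst.comp .fst) .snd)).to₂
    (hlam.comp (Primrec.fst.comp .fst)).to₂).to₂).of_eq fun x => ?_
  obtain ⟨x, c⟩ := x
  cases c <;> rfl

theorem primrec_rowLeaves : Primrec₂ rowLeaves := by
  refine Primrec.list_headI.comp (Primrec.list_foldl
    (h := fun (x : ℕ × List Letter) (y : List (List Leaf) × Letter) => leafStep x.1 y.1 y.2)
    .snd (Primrec.const []) ?_)
  exact primrec_leafStep.comp (Primrec.pair (Primrec.pair (Primrec.fst.comp .fst)
    (Primrec.fst.comp .snd)) (Primrec.snd.comp .snd))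

theorem primrec_paths : Primrec₂ paths := by
  have h : Primrec fun x : ℕ × ℕ × List (List ℕ) =>
      (List.range x.1).flatMap fun i => x.2.2.map fun p => i :: p := by
    refine Primrec.list_flatMap (Primrec.list_range.comp .fst) (Primrec.list_map
      (Primrec.snd.comp (Primrec.snd.comp .fst)) ?_)
    exact Primrec.list_cons.comp (Primrec.snd.comp .fst) .snd
  refine (Primrec.nat_rec (f := fun _ : ℕ => [[]]) (Primrec.const _) h.to₂).of_eq fun n d => ?_
  induction d with
  | zero => rfl
  | succ d ih =>
    simp only [paths, ← ih]

theorem primrec_reduce : Primrec fun x : (ℕ × ℕ) × ℕ × List ℕ => reduce x.1.1 x.1.2 x.2 := by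
  refine Primrec.pair (Primrec.nat_mod.comp (Primrec.fst.comp .snd) (Primrec.snd.comp .fst))
    (Primrec.list_map (Primrec.snd.comp .snd) ?_)
  exact Primrec.nat_mod.comp .snd (Primrec.fst.comp (Primrec.fst.comp .fst))

end Higman

namespace Higman

variable {α δ : Type} [Primcodable α] [Primcodable δ]

section

variable {n : α → ℕ} {w : α → List Letter} {p : α → List ℕ} {a : α → ℕ × List ℕ}

theorem searchable_nodeAt (hn : Primrec n) (hw : Primrec w) (hp : Primrec p) (ha : Primrec a) :
    Searchable fun x => NodeAt (n x) (w x) (p x) (a x) := by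
  have h : Searchable fun x => ∃ (l : Leaf) (s : List ℕ),
      l ∈ rowLeaves (n x) (w x) ∧ p x = l.1 ++ s ∧ a x = ext l.2 s := by
    refine .ex (.ex (.and (.mem (Primrec.snd.comp .fst) ?_) (.and (.eq ?_ ?_) (.eq ?_ ?_))))
    · exact primrec_rowLeaves.comp (hn.comp (Primrec.fst.comp .fst))
        (hw.comp (Primrec.fst.comp .fst))
    · exact hp.comp (Primrec.fst.comp .fst)
    · exact Primrec.list_append.comp (Primrec.fst.comp (Primrec.snd.comp .fst)) .snd
    · exact ha.comp (Primrec.fst.comp .fst)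
    · exact primrec_ext.comp (Primrec.snd.comp (Primrec.snd.comp .fst)) .snd
  exact h.of_iff fun x => by simp [NodeAt]

theorem searchable_fact {L : α → List (List Letter × List Letter)} {b : α → ℕ × List ℕ}
    (hn : Primrec n) (hL : Primrec L) (ha : Primrec a) (hb : Primrec b) :
    Searchable fun x => Fact (n x) (L x) (a x) (b x) := by
  have h : Searchable fun x => ∃ (y : List Letter × List Letter) (p : List ℕ),
      y ∈ L x ∧ NodeAt (n x) y.1 p (a x) ∧ NodeAt (n x) y.2 p (b x) := by
    have h1 : Primrec fun x : (α × List Letter × List Letter) × List ℕ => x.1.1 :=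
      Primrec.fst.comp .fst
    have h2 : Primrec fun x : (α × List Letter × List Letter) × List ℕ => x.1.2 :=
      Primrec.snd.comp .fst
    exact .ex (.ex (.and (.mem h2 (hL.comp h1)) (.and
      (searchable_nodeAt (hn.comp h1) (Primrec.fst.comp h2) .snd (ha.comp h1))
      (searchable_nodeAt (hn.comp h1) (Primrec.snd.comp h2) .snd (hb.comp h1)))))
  exact h.of_iff fun x => by simp [Fact]

end

theorem searchable_steps {R : α → δ → δ → Prop}
    (hR : Searchable fun x : α × δ × δ => R x.1 x.2.1 x.2.2) {m : α → ℕ} {a b : α → δ}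
    (hm : Primrec m) (ha : Primrec a) (hb : Primrec b) :
    Searchable fun x => Steps (R x) (m x) (a x) (b x) := by
  refine Searchable.of_iff ?_ fun x => steps_iff_exists_list
  have h : Searchable fun y : (α × List δ) × ℕ => ∃ c d,
      y.1.2[y.2]? = some c ∧ y.1.2[y.2 + 1]? = some d ∧ R y.1.1 c d := by
    -- the variables `x`, `l`, `i`, `c`, `d`
    let T := (((α × List δ) × ℕ) × δ) × δ
    have hx : Primrec fun z : T => z.1.1.1.1 :=
      Primrec.fst.comp (Primrec.fst.comp (Primrec.fst.comp .fst))
    have hl : Primrec fun z : T => z.1.1.1.2 :=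
      Primrec.snd.comp (Primrec.fst.comp (Primrec.fst.comp .fst))
    have hi : Primrec fun z : T => z.1.1.2 := Primrec.snd.comp (Primrec.fst.comp .fst)
    have hc : Primrec fun z : T => z.1.2 := Primrec.snd.comp .fst
    have hd : Primrec fun z : T => z.2 := Primrec.snd
    exact .ex (.ex (.and
      (.eq (Primrec.list_getElem?.comp hl hi) (Primrec.option_some.comp hc)) (.and
      (.eq (Primrec.list_getElem?.comp hl (Primrec.succ.comp hi)) (Primrec.option_some.comp hd))
      (hR.comp (hx.pair (hc.pair hd))))))
  exact .ex (.and
    (.eq (Primrec.list_getElem?.comp .snd (Primrec.const 0)) (Primrec.option_some.comp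
      (ha.comp .fst))) (.and
    (.eq (Primrec.list_getElem?.comp .snd (hm.comp .fst)) (Primrec.option_some.comp (hb.comp .fst)))
    (h.forall_lt (hm.comp .fst))))

theorem searchable_avoids {R : α → ℕ × List ℕ → ℕ × List ℕ → Prop}
    (hR : Searchable fun x : α × (ℕ × List ℕ) × (ℕ × List ℕ) => R x.1 x.2.1 x.2.2) {m : α → ℕ}
    {a b : α → ℕ × List ℕ} (hm : Primrec m) (ha : Primrec a) (hb : Primrec b) :
    Searchable fun x => Avoids (R x) (m x) (a x) (b x) := by
  -- the variables `x`, `k`, `t`, `s`, `Γ`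
  let T := (((α × ℕ) × (ℕ × List ℕ)) × List ℕ) × List ℕ
  have hx : Primrec fun z : T => z.1.1.1.1 :=
    Primrec.fst.comp (Primrec.fst.comp (Primrec.fst.comp .fst))
  have hk : Primrec fun z : T => z.1.1.1.2 :=
    Primrec.snd.comp (Primrec.fst.comp (Primrec.fst.comp .fst))
  have ht : Primrec fun z : T => z.1.1.2 := Primrec.snd.comp (Primrec.fst.comp .fst)
  have hs : Primrec fun z : T => z.1.2 := Primrec.snd.comp .fst
  have hΓ : Primrec fun z : T => z.2 := Primrec.snd
  have hR' : Searchable fun y : T × (ℕ × List ℕ) × (ℕ × List ℕ) => R y.1.1.1.1.1 y.2.1 y.2.2 :=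
    hR.comp (Primrec.pair (hx.comp .fst) .snd)
  exact .ex (.ex (.ex (.ex (.and (.lt (Primrec.const 0) hk) (.and
    (.lt (Primrec.list_length.comp (Primrec.snd.comp (hb.comp hx))) (Primrec.list_length.comp hs))
    (.and (searchable_steps hR' (hm.comp hx) (ha.comp hx) (primrec_ext.comp ht hs))
      (searchable_steps hR' hk ht (primrec_ext.comp ht hΓ))))))))

section Rows

variable {n r m : α → ℕ} {L : α → List (List Letter × List Letter)} {u v : α → List Letter}

theorem searchable_fact_rel (hn : Primrec n) (hL : Primrec L) :
    Searchable fun x : α × (ℕ × List ℕ) × (ℕ × List ℕ) => Fact (n x.1) (L x.1) x.2.1 x.2.2 :=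
  searchable_fact (hn.comp .fst) (hL.comp .fst) (Primrec.fst.comp .snd) (Primrec.snd.comp .snd)

theorem searchable_flip_fact_rel (hn : Primrec n) (hL : Primrec L) :
    Searchable fun x : α × (ℕ × List ℕ) × (ℕ × List ℕ) =>
      flip (Fact (n x.1) (L x.1)) x.2.1 x.2.2 :=
  searchable_fact (hn.comp .fst) (hL.comp .fst) (Primrec.snd.comp .snd) (Primrec.fst.comp .snd)

theorem searchable_reduce_ne (hn : Primrec n) (hr : Primrec r) {a b : α → ℕ × List ℕ}
    (ha : Primrec a) (hb : Primrec b) :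
    Searchable fun x => reduce (n x) (r x) (a x) ≠ reduce (n x) (r x) (b x) :=
  .ne (primrec_reduce.comp ((hn.pair hr).pair ha)) (primrec_reduce.comp ((hn.pair hr).pair hb))

theorem searchable_mapsTo (hn : Primrec n) (hL : Primrec L) (hm : Primrec m) (hu : Primrec u)
    (hv : Primrec v) : Searchable fun x => MapsTo (n x) (L x) (m x) (u x) (v x) := by
  -- the variables `x`, `d`, `p`, `a`, `b`
  let T := (((α × ℕ) × List ℕ) × (ℕ × List ℕ)) × (ℕ × List ℕ)
  have hx : Primrec fun z : T => z.1.1.1.1 :=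
    Primrec.fst.comp (Primrec.fst.comp (Primrec.fst.comp .fst))
  have hp : Primrec fun z : T => z.1.1.2 := Primrec.snd.comp (Primrec.fst.comp .fst)
  have ha : Primrec fun z : T => z.1.2 := Primrec.snd.comp .fst
  have hb : Primrec fun z : T => z.2 := Primrec.snd
  have h : Searchable fun z : (α × ℕ) × List ℕ => ∃ a b, NodeAt (n z.1.1) (u z.1.1) z.2 a ∧
      NodeAt (n z.1.1) (v z.1.1) z.2 b ∧ Steps (Fact (n z.1.1) (L z.1.1)) (m z.1.1) a b :=
    .ex (.ex (.and (searchable_nodeAt (hn.comp hx) (hu.comp hx) hp ha)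
      (.and (searchable_nodeAt (hn.comp hx) (hv.comp hx) hp hb)
        (searchable_steps (searchable_fact_rel (hn.comp hx) (hL.comp hx)) (hm.comp hx) ha hb))))
  exact .ex (h.forall_mem (primrec_paths.comp (hn.comp .fst) .snd))

theorem searchable_notMapsTo (hn : Primrec n) (hr : Primrec r) (hL : Primrec L) (hm : Primrec m)
    (hu : Primrec u) (hv : Primrec v) :
    Searchable fun x => NotMapsTo (n x) (r x) (L x) (m x) (u x) (v x) := by
  -- the variables `x`, `p`, `a`, `b`, `c`
  let T := (((α × List ℕ) × (ℕ × List ℕ)) × (ℕ × List ℕ)) × (ℕ × List ℕ)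
  have hx : Primrec fun z : T => z.1.1.1.1 :=
    Primrec.fst.comp (Primrec.fst.comp (Primrec.fst.comp .fst))
  have hp : Primrec fun z : T => z.1.1.1.2 :=
    Primrec.snd.comp (Primrec.fst.comp (Primrec.fst.comp .fst))
  have ha : Primrec fun z : T => z.1.1.2 := Primrec.snd.comp (Primrec.fst.comp .fst)
  have hb : Primrec fun z : T => z.1.2 := Primrec.snd.comp .fst
  have hc : Primrec fun z : T => z.2 := Primrec.snd
  exact .ex (.ex (.ex (.ex (.and (searchable_nodeAt (hn.comp hx) (hu.comp hx) hp ha)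
    (.and (searchable_nodeAt (hn.comp hx) (hv.comp hx) hp hb)
    (.and (searchable_steps (searchable_fact_rel (hn.comp hx) (hL.comp hx)) (hm.comp hx) ha hc)
      (searchable_reduce_ne (hn.comp hx) (hr.comp hx) hc hb)))))))

theorem searchable_eventuallyAvoids (hn : Primrec n) (hL : Primrec L) (hm : Primrec m)
    (hu : Primrec u) (hv : Primrec v) :
    Searchable fun x => EventuallyAvoids (n x) (L x) (m x) (u x) (v x) := by
  -- the variables `x`, `p`, `a`, `b`
  let T := ((α × List ℕ) × (ℕ × List ℕ)) × (ℕ × List ℕ)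
  have hx : Primrec fun z : T => z.1.1.1 := Primrec.fst.comp (Primrec.fst.comp .fst)
  have hp : Primrec fun z : T => z.1.1.2 := Primrec.snd.comp (Primrec.fst.comp .fst)
  have ha : Primrec fun z : T => z.1.2 := Primrec.snd.comp .fst
  have hb : Primrec fun z : T => z.2 := Primrec.snd
  exact .ex (.ex (.ex (.and (searchable_nodeAt (hn.comp hx) (hu.comp hx) hp ha)
    (.and (searchable_nodeAt (hn.comp hx) (hv.comp hx) hp hb)
    (.or
      (searchable_avoids (searchable_fact_rel (hn.comp hx) (hL.comp hx)) (hm.comp hx) ha hb)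
      (searchable_avoids (searchable_flip_fact_rel (hn.comp hx) (hL.comp hx)) (hm.comp hx)
        hb ha))))))

theorem searchable_neverMapsTo (hn : Primrec n) (hr : Primrec r) (hL : Primrec L)
    (hu : Primrec u) (hv : Primrec v) :
    Searchable fun x => NeverMapsTo (n x) (r x) (L x) (u x) (v x) := by
  have hx : Primrec fun z : (α × ℕ) × ℕ => z.1.1 := Primrec.fst.comp .fst
  exact .ex (.and
    (searchable_eventuallyAvoids (hn.comp .fst) (hL.comp .fst) .snd (hu.comp .fst) (hv.comp .fst))
    (.forall_lt (searchable_notMapsTo (hn.comp hx) (hr.comp hx) (hL.comp hx) .snd (hu.comp hx)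
      (hv.comp hx)) .snd))

theorem searchable_separated (hn : Primrec n) (hr : Primrec r) (hL : Primrec L)
    (hu : Primrec u) (hv : Primrec v) :
    Searchable fun x => Separated (n x) (r x) (L x) (u x) (v x) := by
  -- the variables `x`, `k`, `p`, `p'`, `a`, `a'`, `b`, `b'`, `c`
  let T₄ := ((α × ℕ) × List ℕ) × List ℕ
  let T := ((((T₄ × (ℕ × List ℕ)) × (ℕ × List ℕ)) × (ℕ × List ℕ)) × (ℕ × List ℕ)) × (ℕ × List ℕ)
  have h₄ : Primrec fun z : T => z.1.1.1.1.1 :=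
    Primrec.fst.comp (Primrec.fst.comp (Primrec.fst.comp (Primrec.fst.comp .fst)))
  have hx : Primrec fun z : T => z.1.1.1.1.1.1.1.1 :=
    Primrec.fst.comp (Primrec.fst.comp (Primrec.fst.comp h₄))
  have hk : Primrec fun z : T => z.1.1.1.1.1.1.1.2 :=
    Primrec.snd.comp (Primrec.fst.comp (Primrec.fst.comp h₄))
  have hp : Primrec fun z : T => z.1.1.1.1.1.1.2 := Primrec.snd.comp (Primrec.fst.comp h₄)
  have hp' : Primrec fun z : T => z.1.1.1.1.1.2 := Primrec.snd.comp h₄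
  have ha : Primrec fun z : T => z.1.1.1.1.2 :=
    Primrec.snd.comp (Primrec.fst.comp (Primrec.fst.comp (Primrec.fst.comp .fst)))
  have ha' : Primrec fun z : T => z.1.1.1.2 :=
    Primrec.snd.comp (Primrec.fst.comp (Primrec.fst.comp .fst))
  have hb : Primrec fun z : T => z.1.1.2 := Primrec.snd.comp (Primrec.fst.comp .fst)
  have hb' : Primrec fun z : T => z.1.2 := Primrec.snd.comp .fst
  have hc : Primrec fun z : T => z.2 := Primrec.snd
  have hF := searchable_fact_rel (hn.comp hx) (hL.comp hx)
  exact .ex (.ex (.ex (.ex (.ex (.ex (.ex (.ex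
    (.and (searchable_nodeAt (hn.comp hx) (hu.comp hx) hp ha)
    (.and (searchable_nodeAt (hn.comp hx) (hu.comp hx) hp' ha')
    (.and (searchable_nodeAt (hn.comp hx) (hv.comp hx) hp hb)
    (.and (searchable_nodeAt (hn.comp hx) (hv.comp hx) hp' hb')
    (.and (searchable_steps hF hk ha ha')
    (.and (searchable_steps hF hk hb hc)
      (searchable_reduce_ne (hn.comp hx) (hr.comp hx) hc hb'))))))))))))))

theorem searchable_differentOrbits (hn : Primrec n) (hr : Primrec r) (hL : Primrec L)
    (hu : Primrec u) (hv : Primrec v) :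
    Searchable fun x => DifferentOrbits (n x) (r x) (L x) (u x) (v x) := by
  have hx : Primrec fun z : (α × ℕ) × ℕ => z.1.1 := Primrec.fst.comp .fst
  exact .or (.and (searchable_neverMapsTo hn hr hL hu hv) (searchable_neverMapsTo hn hr hL hv hu))
    (.or (searchable_separated hn hr hL hu hv) (.or (searchable_separated hn hr hL hv hu)
    (.ex (.and (.lt (Primrec.const 0) .snd) (.and
      (searchable_mapsTo (hn.comp .fst) (hL.comp .fst) .snd (hu.comp .fst) (hu.comp .fst))
      (.forall_lt (searchable_notMapsTo (hn.comp hx) (hr.comp hx) (hL.comp hx) .snd (hu.comp hx)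
        (hv.comp hx)) .snd))))))

theorem primrec_int_natCast : Primrec fun m : ℕ => (m : ℤ) :=
  Primrec.encode_iff.1 ((Primrec.nat_mul.comp (Primrec.const 2) .id).of_eq fun _ => rfl)

theorem primrec_int_neg_natCast : Primrec fun m : ℕ => -(m : ℤ) :=
  Primrec.encode_iff.1 ((Primrec.nat_sub.comp (Primrec.nat_mul.comp (Primrec.const 2) .id)
    (Primrec.const 1)).of_eq fun m => by
      cases m with
      | zero => rfl
      | succ m => exact (by omega : 2 * (m + 1) - 1 = 2 * m + 1))

theorem searchable_certified (hn : Primrec n) (hr : Primrec r) (hL : Primrec L)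
    (hu : Primrec u) (hv : Primrec v) {ans : α → Option (ℤ × ℕ)} (hans : Primrec ans) :
    Searchable fun x => Certified (n x) (r x) (L x) (u x) (v x) (ans x) := by
  have hx : Primrec fun z : (α × ℕ) × ℕ => z.1.1 := Primrec.fst.comp .fst
  have hx' : Primrec fun z : ((α × ℕ) × ℕ) × ℕ => z.1.1.1 :=
    Primrec.fst.comp (Primrec.fst.comp .fst)
  have hm : Primrec fun z : (α × ℕ) × ℕ => z.1.2 := Primrec.snd.comp .fst
  refine .or (.and (.eq hans (Primrec.const none)) (searchable_differentOrbits hn hr hL hu hv))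
    (.or (.ex (.ex (.and (.eq (hans.comp hx) ?_) (.and (.lt (Primrec.const 0) .snd) (.and
      (searchable_mapsTo (hn.comp hx) (hL.comp hx) hm (hu.comp hx) (hv.comp hx)) (.and
      (searchable_mapsTo (hn.comp hx) (hL.comp hx) .snd (hu.comp hx) (hu.comp hx))
      (.forall_lt (.or (.eq .snd (Primrec.const 0)) (searchable_notMapsTo (hn.comp hx')
        (hr.comp hx') (hL.comp hx') .snd (hu.comp hx') (hu.comp hx'))) .snd)))))))
    (.ex (.and (.or (.and (.eq (hans.comp .fst) ?_) (searchable_mapsTo (hn.comp .fst)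
      (hL.comp .fst) .snd (hu.comp .fst) (hv.comp .fst)))
      (.and (.eq (hans.comp .fst) ?_) (searchable_mapsTo (hn.comp .fst)
      (hL.comp .fst) .snd (hv.comp .fst) (hu.comp .fst))))
      (.ex (searchable_eventuallyAvoids (hn.comp hx) (hL.comp hx) .snd (hu.comp hx)
        (hu.comp hx))))))
  · exact Primrec.option_some.comp (Primrec.pair (primrec_int_natCast.comp hm) .snd)
  · exact Primrec.option_some.comp (Primrec.pair (primrec_int_natCast.comp .snd) (Primrec.const 0))
  · exact Primrec.option_some.comp
      (Primrec.pair (primrec_int_neg_natCast.comp .snd) (Primrec.const 0))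

end Rows

end Higman

theorem mainTheorem4 :
    ∃ F : Higman.OrbitInput →. Option (ℤ × ℕ), Partrec F ∧
      ∀ (n r : ℕ), 2 ≤ n → 1 ≤ r →
        ∀ (ψ : Higman.G n r) (L : List (Higman.Word n r × Higman.Word n r)),
          Higman.Describes L ψ →
            ∀ u v : Higman.Word n r,
              ∃ a ∈ F (Higman.orbitInput L u v), Higman.IsOrbitAnswer ψ u.toV v.toV a := by
  have hin : Primrec fun y : Higman.OrbitInput × Option (ℤ × ℕ) => y.1 := Primrec.fst
  obtain ⟨F, hF, h⟩ := Searchable.exists_partrec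
    (p := fun (x : Higman.OrbitInput) ans =>
      Higman.Certified x.1.1 x.1.2 x.2.1 x.2.2.1 x.2.2.2 ans)
    (Higman.searchable_certified (Primrec.fst.comp (Primrec.fst.comp hin))
      (Primrec.snd.comp (Primrec.fst.comp hin)) (Primrec.fst.comp (Primrec.snd.comp hin))
      (Primrec.fst.comp (Primrec.snd.comp (Primrec.snd.comp hin)))
      (Primrec.snd.comp (Primrec.snd.comp (Primrec.snd.comp hin))) Primrec.snd)
  refine ⟨F, hF, fun n r hn hr ψ L hL u v => ?_⟩
  have : NeZero n := ⟨by omega⟩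
  have : NeZero r := ⟨by omega⟩
  obtain ⟨a, ha, hcert⟩ := h (Higman.orbitInput L u v) (Higman.Certified.complete hn hL u v)
  exact ⟨a, ha, hcert.sound hn hL⟩
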